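/- Let $G$ be a (real, Hausdorff, second countable) Lie group of dimension $d\ge 1$ with Lie algebra $\mathfrak g$, let $\Gamma<G$ be a lattice (a discrete subgroup such that $X:=G/\Gamma$ carries a $G$-invariant Borel probability measure), let $\mu$ be the $G$-invariant Borel probability measure on $X$, and let $\mathbf d$ be the Riemannian distance on $X$ induced by a right-invariant Riemannian metric on $G$. Let $(a_t)_{t\in\mathbb R}$ be a one-parameter subgroup of $G$ with $\mathrm{Ad}(a_t)$ diagonalizable: there are a basis $\zeta_1,\dots,\zeta_d$ of $\mathfrak g$ and real numbers $\gamma_1,\dots,\gamma_d$ with $\mathrm{Ad}(a_t)\zeta_i=e^{\gamma_i t}\zeta_i$ for all $t\in\mathbb R$ and all $i$. Put $\gamma=\max_i\gamma_i$. For $f:X\to\mathbb R$ and $\zeta\in\mathfrak g$ let $D_\zeta f(x)=\frac{d}{dt}f(\exp(t\zeta)x)\big|_{t=0}$. For $k\in\mathbb N$ let $W^{(2,k)}(X)$ be the set of $f$ for which all derivatives $D_{\zeta_{n_1}}\cdots D_{\zeta_{n_l}}f$ with $0\le l\le k$ exist and lie in $L^2(X,\mu)$, and put $$S_k(f)^2=\sum_{l=0}^{k}\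 \sum_{1\le n_1,\dots,n_l\le d}\|D_{\zeta_{n_1}}\cdots D_{\zeta_{n_l}}f\|_2^2 .$$ Fix $k\ge 1$ and $\delta>0$, and assume exponential decay of correlations: there is $c>0$ such that for all $f,g\in W^{(2,k)}(X)$ and all $t\ge 0$ $$\Big|\int_X f(x)\,g(a_tx)\,d\mu(x)-\int_X f\,d\mu\int_X g\,d\mu\Big|\le c\,e^{-\delta t}S_k(f)S_k(g).$$ Let $(m_j)_{j\ge 0}$ be a sequence of positive real numbers with $$\rho^{-1}:=\sup_{j\ge 1}\frac{m_{j-1}}{m_j}<\min\Big(1,\frac{\delta}{k\gamma}\Big).$$ Let $\alpha_n<\beta_n$ be natural numbers such that $\alpha_n\to\infty$ and $N_n:=\beta_n-\alpha_n+1\to\infty$ as $n\to\infty$, and assume $$N_n=o\big(e^{\sigma\rho^{\alpha_n}}\big),\qquad \sigma:=\frac{-m_0}{k\left(\frac32+\frac2d\right)+\frac12}\left(\frac{k\gamma}{\rho}-\delta\right)>0 .$$ Then there is a constant $w>0$ such that for every $x_0\in X$ $$\mu\big(\{x\in X:-\log\mathbf d(x,x_0)\ge z\}\big)=w e^{-dz}+o(e^{-dz})\qquad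 (z\to\infty),$$ and, for every $r\in\mathbb R$, with $u_n(r)=r+\frac1d\log N_n$, $$\lim_{n\to\infty}\mu\Big(\Big\{x\in X:\max_{\alpha_n\le j\le\beta_n}-\log\mathbf d(a_{m_j}x,x_0)\le u_n(r)\Big\}\Big)=e^{-we^{-dr}} .$$ (Here $-\log 0=+\infty$. By the first relation $w$ depends only on $X$, $\mu$ and $\mathbf d$.) -/

import Mathlib

open MeasureTheory Filter Asymptotics Bundle Manifold
open scoped Manifold ContDiff Topology ENNReal

noncomputable section

/-! ### Lie groups: the adjoint action and the exponential map -/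

/-- The Lie algebra (tangent space at the identity) of a `d`-dimensional Lie group `G`. -/
abbrev LieAlg (d : ℕ) (G : Type*) [TopologicalSpace G]
    [ChartedSpace (EuclideanSpace ℝ (Fin d)) G] [Group G] : Type _ :=
  GroupLieAlgebra 𝓘(ℝ, EuclideanSpace ℝ (Fin d)) G

/-- `Ad g`, the derivative at the identity of the conjugation `h ↦ g h g⁻¹`. -/
def lieAd (d : ℕ) {G : Type*} [TopologicalSpace G]
    [ChartedSpace (EuclideanSpace ℝ (Fin d)) G] [Group G] (g : G) (v : LieAlg d G) :
    LieAlg d G :=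
  mfderiv 𝓘(ℝ, EuclideanSpace ℝ (Fin d)) 𝓘(ℝ, EuclideanSpace ℝ (Fin d))
    (fun h : G => g * h * g⁻¹) 1 v

/-- Left-invariant vector fields on a Lie group are complete. -/
theorem exists_isMIntegralCurve_mulInvariantVectorField {d : ℕ} {G : Type*} [TopologicalSpace G]
    [T2Space G] [ChartedSpace (EuclideanSpace ℝ (Fin d)) G] [Group G]
    [LieGroup 𝓘(ℝ, EuclideanSpace ℝ (Fin d)) ∞ G] (v : LieAlg d G) :
    ∃ c : ℝ → G, c 0 = 1 ∧ IsMIntegralCurve (I := 𝓘(ℝ, EuclideanSpace ℝ (Fin d))) c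
      (mulInvariantVectorField v) := by
  have : LieGroup 𝓘(ℝ, EuclideanSpace ℝ (Fin d)) (minSmoothness ℝ 3) G := by
    simp only [minSmoothness_of_isRCLikeNormedField]; infer_instance
  have : IsManifold 𝓘(ℝ, EuclideanSpace ℝ (Fin d)) 1 G := inferInstance
  have hv : ContMDiff 𝓘(ℝ, EuclideanSpace ℝ (Fin d)) (𝓘(ℝ, EuclideanSpace ℝ (Fin d))).tangent 1
      (fun g : G => (⟨g, mulInvariantVectorField v g⟩ :
        TangentBundle 𝓘(ℝ, EuclideanSpace ℝ (Fin d)) G)) := by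
    refine (contMDiff_mulInvariantVectorField v).of_le ?_
    simp only [minSmoothness_of_isRCLikeNormedField]; norm_num
  obtain ⟨c, hc0, hc⟩ := exists_isMIntegralCurveAt_of_contMDiffAt_boundaryless
    (I := 𝓘(ℝ, EuclideanSpace ℝ (Fin d))) 0 (hv.contMDiffAt (x := (1 : G)))
  rw [isMIntegralCurveAt_iff'] at hc
  obtain ⟨ε, hε, hc⟩ := hc
  refine exists_isMIntegralCurve_of_isMIntegralCurveOn hv hε (fun x => ?_) 1
  refine ⟨fun t => x * c t, by simp [hc0], ?_⟩
  intro t ht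
  have h1 := hc t (by simpa [Real.ball_eq_Ioo] using ht)
  have hL : ∀ g h : G, MDifferentiableAt 𝓘(ℝ, EuclideanSpace ℝ (Fin d))
      𝓘(ℝ, EuclideanSpace ℝ (Fin d)) (fun y : G => g * y) h := fun g h =>
    (contMDiff_mul_left (I := 𝓘(ℝ, EuclideanSpace ℝ (Fin d))) (n := 1)
      (a := g)).mdifferentiable one_ne_zero h
  have h2 := (hL x (c t)).hasMFDerivAt.comp_hasMFDerivWithinAt t h1
  have hm : (fun y : G => x * c t * y) = (fun y => x * y) ∘ (fun y => c t * y) := by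
    ext y; simp [mul_assoc]
  have h3 : mulInvariantVectorField (I := 𝓘(ℝ, EuclideanSpace ℝ (Fin d))) v (x * c t) =
      mfderiv 𝓘(ℝ, EuclideanSpace ℝ (Fin d)) 𝓘(ℝ, EuclideanSpace ℝ (Fin d)) (fun y => x * y) (c t)
        (mulInvariantVectorField (I := 𝓘(ℝ, EuclideanSpace ℝ (Fin d))) v (c t)) := by
    have key : ∀ p : G, p = c t → HasMFDerivAt 𝓘(ℝ, EuclideanSpace ℝ (Fin d))
        𝓘(ℝ, EuclideanSpace ℝ (Fin d)) (fun y : G => x * y) p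
        (mfderiv 𝓘(ℝ, EuclideanSpace ℝ (Fin d)) 𝓘(ℝ, EuclideanSpace ℝ (Fin d))
          (fun y => x * y) (c t)) := by
      rintro _ rfl
      exact (hL x _).hasMFDerivAt
    have h4 := ((key (c t * 1) (mul_one _)).comp (1 : G) (hL (c t) 1).hasMFDerivAt).mfderiv
    rw [← hm] at h4
    exact congrArg (fun L => L v) h4
  have hset : Set.Ioo (-ε) ε = Metric.ball 0 ε := by simp [Real.ball_eq_Ioo]
  rw [h3, hset]
  refine HasMFDerivWithinAt.congr_mfderiv h2 ?_
  ext1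
  exact ((mfderiv 𝓘(ℝ, EuclideanSpace ℝ (Fin d)) 𝓘(ℝ, EuclideanSpace ℝ (Fin d))
    (fun y : G => x * y) (c t)).map_smul (1 : ℝ) _)

/-- The one-parameter subgroup `t ↦ exp (t v)`: the integral curve through the identity of the
left-invariant vector field of `v`. -/
def expCurve {d : ℕ} {G : Type*} [TopologicalSpace G]
    [T2Space G] [ChartedSpace (EuclideanSpace ℝ (Fin d)) G] [Group G]
    [LieGroup 𝓘(ℝ, EuclideanSpace ℝ (Fin d)) ∞ G] (v : LieAlg d G) : ℝ → G :=
  (exists_isMIntegralCurve_mulInvariantVectorField v).choose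

theorem expCurve_spec {d : ℕ} {G : Type*} [TopologicalSpace G]
    [T2Space G] [ChartedSpace (EuclideanSpace ℝ (Fin d)) G] [Group G]
    [LieGroup 𝓘(ℝ, EuclideanSpace ℝ (Fin d)) ∞ G] (v : LieAlg d G) :
    expCurve v 0 = 1 ∧ IsMIntegralCurve (I := 𝓘(ℝ, EuclideanSpace ℝ (Fin d))) (expCurve v)
      (mulInvariantVectorField v) :=
  (exists_isMIntegralCurve_mulInvariantVectorField v).choose_spec

/-! ### Derivatives, Sobolev norms and exponential mixing on `X = G ⧸ Γ` -/

section Sobolev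

variable {d : ℕ} {G : Type*} [TopologicalSpace G] [T2Space G]
  [ChartedSpace (EuclideanSpace ℝ (Fin d)) G] [Group G]
  [LieGroup 𝓘(ℝ, EuclideanSpace ℝ (Fin d)) ∞ G] {Γ : Subgroup G}

/-- `D_v f (x) = d/dt f(exp(t v) x)` at `t = 0`. -/
def lieDeriv (v : LieAlg d G) (f : G ⧸ Γ → ℝ) (x : G ⧸ Γ) : ℝ :=
  deriv (fun t : ℝ => f (expCurve v t • x)) 0

/-- `D_{ζ (n 0)} ⋯ D_{ζ (n (l - 1))} f`. -/
def iterLieDeriv (ζ : Fin d → LieAlg d G) :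
    (l : ℕ) → (Fin l → Fin d) → (G ⧸ Γ → ℝ) → G ⧸ Γ → ℝ
  | 0, _, f => f
  | l + 1, n, f => lieDeriv (ζ (n 0)) (iterLieDeriv ζ l (Fin.tail n) f)

variable [MeasurableSpace (G ⧸ Γ)]

/-- Membership in `W^{(2,k)}(X)`: all iterated derivatives of order at most `k` along the `ζ i`
exist and belong to `L²`. -/
structure MemSobolev (ζ : Fin d → LieAlg d G) (μ : Measure (G ⧸ Γ)) (k : ℕ)
    (f : G ⧸ Γ → ℝ) : Prop where
  differentiableAt : ∀ l < k, ∀ (n : Fin l → Fin d) (i : Fin d) (x : G ⧸ Γ),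
    DifferentiableAt ℝ (fun t : ℝ => iterLieDeriv ζ l n f (expCurve (ζ i) t • x)) 0
  memLp : ∀ l ≤ k, ∀ n : Fin l → Fin d, MemLp (iterLieDeriv ζ l n f) 2 μ

/-- The `k`-th Sobolev norm `S_k` (the term `l = 0` of the sum is `‖f‖₂²`). -/
def sobolevNorm (ζ : Fin d → LieAlg d G) (μ : Measure (G ⧸ Γ)) (k : ℕ)
    (f : G ⧸ Γ → ℝ) : ℝ :=
  Real.sqrt (∑ l ∈ Finset.range (k + 1), ∑ n : Fin l → Fin d,
    (eLpNorm (iterLieDeriv ζ l n f) 2 μ).toReal ^ 2)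

/-- Exponential decay of correlations, at rate `δ`, of the flow `a` against `W^{(2,k)}` Sobolev
observables: the constants are uniform over the observables. -/
def HasExpDecay (a : Multiplicative ℝ →ₜ* G) (ζ : Fin d → LieAlg d G) (μ : Measure (G ⧸ Γ))
    (k : ℕ) (δ : ℝ) : Prop :=
  ∃ c : ℝ, 0 < c ∧ ∀ f g : G ⧸ Γ → ℝ, MemSobolev ζ μ k f → MemSobolev ζ μ k g →
    ∀ t : ℝ, 0 ≤ t →
      |∫ x, f x * g (a (Multiplicative.ofAdd t) • x) ∂μ - (∫ x, f x ∂μ) * ∫ x, g x ∂μ|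
        ≤ c * Real.exp (-(δ * t)) * sobolevNorm ζ μ k f * sobolevNorm ζ μ k g

end Sobolev

/-! ### The Riemannian distance on `X = G ⧸ Γ` and the closest-return observable -/

section Metric

variable (d : ℕ) {G : Type*} [TopologicalSpace G] [ChartedSpace (EuclideanSpace ℝ (Fin d)) G]
  [Group G] [RiemannianBundle (fun x : G => TangentSpace 𝓘(ℝ, EuclideanSpace ℝ (Fin d)) x)]

variable (G) in
/-- The Riemannian metric on `G` is invariant under all right translations. -/
def IsRightInvariantMetric : Prop :=
  ∀ (x h : G) (v w : TangentSpace 𝓘(ℝ, EuclideanSpace ℝ (Fin d)) x),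
    inner ℝ
      (mfderiv 𝓘(ℝ, EuclideanSpace ℝ (Fin d)) 𝓘(ℝ, EuclideanSpace ℝ (Fin d)) (· * h) x v)
      (mfderiv 𝓘(ℝ, EuclideanSpace ℝ (Fin d)) 𝓘(ℝ, EuclideanSpace ℝ (Fin d)) (· * h) x w)
      = inner ℝ v w

/-- The Riemannian distance on `X = G ⧸ Γ` (for `Γ` discrete and a right-invariant metric on `G`):
since the paths in `X` are the projections of the paths in `G`, it is the infimum of the lengths of
the paths in `G` that start above `x` and end above `y`. -/
def homEDist {Γ : Subgroup G} (x y : G ⧸ Γ) : ℝ≥0∞ :=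
  ⨅ (g : G) (h : G) (_ : (g : G ⧸ Γ) = x) (_ : (h : G ⧸ Γ) = y),
    riemannianEDist 𝓘(ℝ, EuclideanSpace ℝ (Fin d)) g h

/-- The observable `-log d(·, x₀)`, with the value `+∞` at `x₀`. -/
def negLogDist {Γ : Subgroup G} (x₀ x : G ⧸ Γ) : EReal :=
  -ENNReal.log (homEDist d x x₀)

/-- `M_{I}(x) = max_{α ≤ j ≤ β} -log d(a_{m_j} x, x₀)` (the index set is non-empty if `α ≤ β`). -/
def maxReturn {Γ : Subgroup G} (a : Multiplicative ℝ →ₜ* G) (m : ℕ → ℝ) (α β : ℕ)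
    (x₀ x : G ⧸ Γ) : EReal :=
  (Finset.Icc α β).sup fun j => negLogDist d x₀ (a (Multiplicative.ofAdd (m j)) • x)

end Metric

end

/-!
The event `max_j -log d(a_{m_j} x, x₀) ≤ u` says that none of the `N` points `a_{m_j} x` of the
window lies in the open ball of radius `R = exp (-u)` about `x₀`. With `u = r + (1 / d) log N` this
ball has measure about `w R ^ d = w exp (-d r) / N`, so for independent visits the probability is
`(1 - w exp (-d r) / N) ^ N → exp (-w exp (-d r))`. There are two things to prove: the asymptotics
of the measure of balls, and asymptotic independence.

*Measure of balls.* The measure `μ` lifts to a Haar measure on `G` (`exists_lift_measure`). A group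
with a lattice is unimodular (`modularCharacterFun_eq_one_of_lift`, by Poincaré recurrence), so that
this Haar measure is right-invariant, and hence a multiple of the `d`-dimensional Hausdorff measure
of the right-invariant metric. A chart at the identity, suitably normalized, is isometric up to a
factor close to `1` (`exists_chart_almost_isometric`), so the Hausdorff measure of a ball of radius
`R` is asymptotic to `κ R ^ d`. As balls in `G ⧸ Γ` are projections of translates of balls at the
identity, the limit is the same for all `x₀` (`exists_tendsto_measure_homEDist_lt`).

*Independence.* The indicator of a ball of radius `R` is squeezed between smooth bump functions for
balls whose radii differ from `R` by a factor `b`, and whose derivatives of order `l` are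
`O(R ^ (-l))` (`exists_bump_homEDist`). Such bounds are recorded by `HasDerivBound`: they multiply
under products, and translation by `a_t` multiplies the rate by `exp (γ t)`, as
`D_{ζ i} (f ∘ a_t) = exp (γ_i t) (D_{ζ i} f) ∘ a_t` (`lieDeriv_smul_left`). Mixing, applied to the
last factor against the product of the earlier ones, gives
`∫ ∏ f(a_{m_j} x) = (∫ f) ^ N + O(N ^ (1 + k) R ^ (-2 k) exp (-(δ - k γ / ρ) m_α))`, because
`m_{j-1} ≤ m_j / ρ` (`exists_abs_integral_prod_sub_pow_le`). The growth `m_α ≥ m_0 ρ ^ α` and the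
condition on the window length make the error negligible (`tendsto_error_bound`). Finally `b → 1`.
-/

open scoped NNReal

/-! ### Charts that are almost isometric -/

theorem enorm_le_mul_enorm_of_norm_le {V W : Type*} [SeminormedAddGroup V]
    [SeminormedAddGroup W] {v : V} {w : W} {c : ℝ≥0} (h : ‖v‖ ≤ c * ‖w‖) :
    ‖v‖ₑ ≤ c * ‖w‖ₑ := by
  simp only [enorm]
  exact_mod_cast (show ‖v‖₊ ≤ c * ‖w‖₊ from h)

section Riemannian

variable {d : ℕ} {M : Type*} [TopologicalSpace M] [ChartedSpace (EuclideanSpace ℝ (Fin d)) M]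
  [IsManifold (𝓡 d) 1 M]
  [RiemannianBundle (fun x : M => TangentSpace (𝓡 d) x)]
  [IsContinuousRiemannianBundle (EuclideanSpace ℝ (Fin d))
    (fun x : M => TangentSpace (𝓡 d) x)]

/-- The trivialization of the tangent bundle at `p`, normalized to be isometric on `T_p M`, distorts
the Riemannian norm near `p` by a factor arbitrarily close to `1`. -/
theorem exists_chart_almost_isometric_mfderiv (p : M) :
    ∃ A : EuclideanSpace ℝ (Fin d) ≃L[ℝ] EuclideanSpace ℝ (Fin d), ∀ c : ℝ≥0, 1 < c →
      ∀ᶠ y in 𝓝 p,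
        (∀ v : TangentSpace (𝓡 d) y,
          ‖A (mfderiv (𝓡 d) (𝓡 d) (extChartAt (𝓡 d) p) y v)‖ₑ ≤ c * ‖v‖ₑ) ∧
        (∀ u : EuclideanSpace ℝ (Fin d),
          ‖mfderivWithin (𝓡 d) (𝓡 d) (extChartAt (𝓡 d) p).symm (Set.range (𝓡 d))
            (extChartAt (𝓡 d) p y) u‖ₑ ≤ c * ‖A u‖ₑ) := by
  let T := fun x : M => TangentSpace (𝓡 d) x
  have : FiniteDimensional ℝ (T p) :=
    inferInstanceAs (FiniteDimensional ℝ (EuclideanSpace ℝ (Fin d)))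
  have hrank : Module.finrank ℝ (T p) = d := finrank_euclideanSpace_fin (𝕜 := ℝ) (n := d)
  let τ := trivializationAt (EuclideanSpace ℝ (Fin d)) T p
  have hp : p ∈ τ.baseSet := FiberBundle.mem_baseSet_trivializationAt' p
  let L : T p ≃L[ℝ] EuclideanSpace ℝ (Fin d) := τ.continuousLinearEquivAt ℝ p hp
  let J : T p ≃ₗᵢ[ℝ] EuclideanSpace ℝ (Fin d) :=
    ((stdOrthonormalBasis ℝ (T p)).reindex (finCongr hrank)).repr
  refine ⟨L.symm.trans J.toContinuousLinearEquiv, fun c hc => ?_⟩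
  have hc' : (1 : ℝ) < c := by exact_mod_cast hc
  filter_upwards [eventually_norm_symmL_trivializationAt_self_comp_lt (EuclideanSpace ℝ (Fin d))
      T p hc', eventually_norm_symmL_trivializationAt_comp_self_lt (EuclideanSpace ℝ (Fin d))
      T p hc', chart_source_mem_nhds (EuclideanSpace ℝ (Fin d)) p] with y h1 h2 hy
  have hL : ∀ u, L.symm u = τ.symmL ℝ p u := fun u =>
    congrFun (τ.symm_continuousLinearEquivAt_eq (R := ℝ) hp) u
  constructor
  · intro v
    have key : ‖(τ.symmL ℝ p) (τ.continuousLinearMapAt ℝ y v)‖ ≤ c * ‖v‖ :=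
      (ContinuousLinearMap.le_opNorm ((τ.symmL ℝ p) ∘L (τ.continuousLinearMapAt ℝ y)) v).trans
        (by gcongr)
    have e : τ.continuousLinearMapAt ℝ y = mfderiv (𝓡 d)
        (𝓡 d) (extChartAt (𝓡 d) p) y :=
      TangentBundle.continuousLinearMapAt_trivializationAt hy
    rw [← e]
    have : ‖(L.symm.trans J.toContinuousLinearEquiv) (τ.continuousLinearMapAt ℝ y v)‖ ≤ c * ‖v‖ :=
      (J.norm_map _).trans_le ((congrArg norm (hL _)).trans_le key)
    exact enorm_le_mul_enorm_of_norm_le this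
  · intro u
    have key : ‖(τ.symmL ℝ y) (τ.continuousLinearMapAt ℝ p (τ.symmL ℝ p u))‖
        ≤ c * ‖τ.symmL ℝ p u‖ :=
      (ContinuousLinearMap.le_opNorm ((τ.symmL ℝ y) ∘L (τ.continuousLinearMapAt ℝ p)) _).trans
        (by gcongr)
    have e : τ.symmL ℝ y = mfderivWithin (𝓡 d)
        (𝓡 d) (extChartAt (𝓡 d) p).symm
        (Set.range (𝓡 d))
        (extChartAt (𝓡 d) p y) :=
      TangentBundle.symmL_trivializationAt hy
    have e2 : τ.continuousLinearMapAt ℝ p (τ.symmL ℝ p u) = u :=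
      τ.continuousLinearMapAt_symmL hp u
    rw [e2] at key
    rw [← e]
    have : ‖τ.symmL ℝ y u‖ ≤ c * ‖(L.symm.trans J.toContinuousLinearEquiv) u‖ :=
      key.trans_eq (congrArg _ ((congrArg norm (hL u)).symm.trans (J.norm_map _).symm))
    have hz : ∀ z : M, z = y → ∀ w : EuclideanSpace ℝ (Fin d),
        ‖(show TangentSpace (𝓡 d) z from w)‖ₑ = ‖(show TangentSpace (𝓡 d) y from w)‖ₑ := by
      rintro z rfl w
      rfl
    refine (hz _ ?_ _).trans_le (enorm_le_mul_enorm_of_norm_le this)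
    exact (extChartAt (𝓡 d) p).left_inv (by simpa using hy)

/-- Near `p` the chart, followed by a fixed linear map, is an isometry up to a factor arbitrarily
close to `1`. Lengths of paths can be compared in the chart because a nearly minimizing path between
two points that are much closer to `p` than the radius of a Riemannian ball cannot leave the ball. -/
theorem exists_chart_almost_isometric [RegularSpace M] (p : M) :
    ∃ A : EuclideanSpace ℝ (Fin d) ≃L[ℝ] EuclideanSpace ℝ (Fin d), ∀ c : ℝ≥0, 1 < c →
      ∃ U ∈ 𝓝 p, ∀ x ∈ U, ∀ y ∈ U,
        edist (A (extChartAt (𝓡 d) p x))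
            (A (extChartAt (𝓡 d) p y))
          ≤ c * riemannianEDist (𝓡 d) x y ∧
        riemannianEDist (𝓡 d) x y
          ≤ c * edist (A (extChartAt (𝓡 d) p x))
            (A (extChartAt (𝓡 d) p y)) := by
  obtain ⟨A, hA⟩ := exists_chart_almost_isometric_mfderiv (d := d) p
  refine ⟨A, fun c hc => ?_⟩
  set φ := extChartAt (𝓡 d) p with hφ
  have hgood := (hA c hc).and (chart_source_mem_nhds (EuclideanSpace ℝ (Fin d)) p)
  -- the region where path lengths upstairs control lengths in the chart
  obtain ⟨r, hr0, hr⟩ := setOfPred_riemannianEDist_lt_subset_nhds' (𝓡 d) hgood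
  have hr3 : 0 < r / 3 := ENNReal.div_pos hr0.ne' (by simp)
  -- the convex region in the chart
  obtain ⟨s, hs0, hs⟩ : ∃ s > 0, Metric.ball (A (φ p)) s ⊆ A.symm ⁻¹' (φ.target ∩ φ.symm ⁻¹'
      {y | (∀ v : TangentSpace (𝓡 d) y, ‖A (mfderiv (𝓡 d) (𝓡 d) φ y v)‖ₑ ≤ c * ‖v‖ₑ) ∧
        (∀ u : EuclideanSpace ℝ (Fin d), ‖(mfderivWithin (𝓡 d) (𝓡 d) φ.symm (Set.range (𝓡 d)) (φ y) u :
              TangentSpace (𝓡 d) y)‖ₑ ≤ c * ‖A u‖ₑ)}) := by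
    apply Metric.mem_nhds_iff.1
    apply A.symm.continuous.continuousAt.preimage_mem_nhds
    rw [A.symm_apply_apply]
    exact inter_mem (extChartAt_target_mem_nhds p)
      ((continuousAt_extChartAt_symm p).preimage_mem_nhds
        (by rw [extChartAt_to_inv]; exact hA c hc))
  have hU2 : (fun x => A (φ x)) ⁻¹' Metric.ball (A (φ p)) s ∈ 𝓝 p :=
    (A.continuous.continuousAt.comp (continuousAt_extChartAt p)).preimage_mem_nhds
      (Metric.ball_mem_nhds _ hs0)
  refine ⟨_, inter_mem (inter_mem (eventually_riemannianEDist_lt (𝓡 d) p hr3) hU2)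
    (chart_source_mem_nhds (EuclideanSpace ℝ (Fin d)) p), ?_⟩
  rintro x ⟨⟨hx1, hx2⟩, hx3⟩ y ⟨⟨hy1, hy2⟩, hy3⟩
  simp only [Set.mem_ofPred_eq] at hx1 hy1
  constructor
  · -- push a nearly minimizing path down to the chart
    have hxy : riemannianEDist (𝓡 d) x y < r / 3 + r / 3 :=
      (riemannianEDist_triangle (y := p)).trans_lt
        (ENNReal.add_lt_add (by rwa [riemannianEDist_comm]) hy1)
    by_contra! hcon
    have hcon' : riemannianEDist (𝓡 d) x y < edist (A (φ x)) (A (φ y)) / c := by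
      rw [ENNReal.lt_div_iff_mul_lt (Or.inl (by simpa using (zero_lt_one.trans hc).ne'))
        (Or.inl (by simp)), mul_comm]
      exact hcon
    obtain ⟨γ, hγ0, hγ1, hγs, hγ, -⟩ :=
      exists_lt_locally_constant_of_riemannianEDist_lt (lt_min hxy hcon') zero_lt_one
    have hin : ∀ t ∈ Set.Icc (0 : ℝ) 1, riemannianEDist (𝓡 d) p (γ t) < r := by
      intro t ht
      have h1 : riemannianEDist (𝓡 d) x (γ t) ≤ pathELength (𝓡 d) γ 0 t :=
        riemannianEDist_le_pathELength hγs.contMDiffOn hγ0 rfl ht.1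
      have h2 : pathELength (𝓡 d) γ 0 t ≤ pathELength (𝓡 d) γ 0 1 := pathELength_mono le_rfl ht.2
      calc riemannianEDist (𝓡 d) p (γ t) ≤ riemannianEDist (𝓡 d) p x + riemannianEDist (𝓡 d) x (γ t) :=
            riemannianEDist_triangle
        _ < r / 3 + (r / 3 + r / 3) :=
            ENNReal.add_lt_add hx1 ((h1.trans h2).trans_lt (hγ.trans_le (min_le_left _ _)))
        _ = r := by rw [← add_assoc]; exact ENNReal.add_thirds r
    have hg := fun t ht => hr (hin t ht)
    let γ' : ℝ → EuclideanSpace ℝ (Fin d) := fun t => A (φ (γ t))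
    have hφγ : ContMDiffOn 𝓘(ℝ, ℝ) (𝓡 d) 1 (fun t => φ (γ t)) (Set.Icc 0 1) :=
      contMDiffOn_extChartAt.comp (I' := 𝓡 d) (t := (chartAt (EuclideanSpace ℝ (Fin d)) p).source)
        hγs.contMDiffOn (fun t ht => (hg t ht).2)
    have hγ'C : ContDiffOn ℝ 1 γ' (Set.Icc 0 1) :=
      A.contDiff.comp_contDiffOn (contMDiffOn_iff_contDiffOn.1 hφγ)
    have key : edist (A (φ x)) (A (φ y)) ≤ c * pathELength (𝓡 d) γ 0 1 := by
      calc edist (A (φ x)) (A (φ y)) = ‖γ' 1 - γ' 0‖ₑ := by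
            rw [edist_comm, edist_eq_enorm_sub]; simp [γ', hγ0, hγ1]
        _ ≤ ∫⁻ t in Set.Icc 0 1, ‖derivWithin γ' (Set.Icc 0 1) t‖ₑ :=
            enorm_sub_le_lintegral_derivWithin_Icc_of_contDiffOn_Icc hγ'C zero_le_one
        _ ≤ ∫⁻ t in Set.Icc 0 1, c * ‖mfderivWithin 𝓘(ℝ, ℝ) (𝓡 d) γ (Set.Icc 0 1) t 1‖ₑ := by
            apply setLIntegral_mono' measurableSet_Icc (fun t ht => ?_)
            have hu := uniqueDiffOn_Icc (zero_lt_one' ℝ) t ht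
            have e1 : mfderivWithin 𝓘(ℝ, ℝ) (𝓡 d) (fun t => φ (γ t)) (Set.Icc 0 1) t =
                (mfderiv (𝓡 d) (𝓡 d) φ (γ t)) ∘L (mfderivWithin 𝓘(ℝ, ℝ) (𝓡 d) γ (Set.Icc 0 1) t) := by
              apply mfderiv_comp_mfderivWithin
              · exact mdifferentiableAt_extChartAt (hg t ht).2
              · exact (hγs.mdifferentiable one_ne_zero).mdifferentiableOn _ ht
              · rw [uniqueMDiffWithinAt_iff_uniqueDiffWithinAt]; exact hu
            have e2 : derivWithin γ' (Set.Icc 0 1) t =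
                A (mfderivWithin 𝓘(ℝ, ℝ) (𝓡 d) (fun t => φ (γ t)) (Set.Icc 0 1) t 1) := by
              rw [mfderivWithin_eq_fderivWithin]
              have hd : DifferentiableWithinAt ℝ (fun t => φ (γ t)) (Set.Icc 0 1) t :=
                (contMDiffOn_iff_contDiffOn.1 hφγ).differentiableOn one_ne_zero t ht
              have := (A.hasFDerivAt.comp_hasFDerivWithinAt t hd.hasFDerivWithinAt)
              exact (this.hasDerivWithinAt).derivWithin hu
            rw [e2, e1]
            exact (hg t ht).1.1 _
        _ = c * pathELength (𝓡 d) γ 0 1 := by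
            rw [lintegral_const_mul' _ _ ENNReal.coe_ne_top,
              pathELength_eq_lintegral_mfderivWithin_Icc]
    have := key.trans_lt (ENNReal.mul_lt_mul_right (by simpa using (zero_lt_one.trans hc).ne')
      (by simp) (hγ.trans_le (min_le_right _ _)))
    rw [ENNReal.mul_div_cancel (by simpa using (zero_lt_one.trans hc).ne') (by simp)] at this
    exact this.false
  · -- pull the segment in the chart up to a path
    let η := ContinuousAffineMap.lineMap (R := ℝ) (φ x) (φ y)
    have hη : ∀ t ∈ Set.Icc (0 : ℝ) 1, η t ∈ A.symm '' Metric.ball (A (φ p)) s := by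
      intro t ht
      have : A (η t) ∈ Metric.ball (A (φ p)) s := by
        have hseg := (convex_ball (A (φ p)) s).segment_subset hx2 hy2
        apply hseg
        rw [segment_eq_image_lineMap]
        refine ⟨t, ht, ?_⟩
        simp [η, ContinuousAffineMap.coe_lineMap_eq, AffineMap.lineMap_apply]
      exact ⟨_, this, A.symm_apply_apply _⟩
    have hη' : ∀ t ∈ Set.Icc (0 : ℝ) 1, η t ∈ φ.target ∧
        ∀ u : EuclideanSpace ℝ (Fin d), ‖(mfderivWithin (𝓡 d) (𝓡 d) φ.symm (Set.range (𝓡 d)) (η t) u :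
              TangentSpace (𝓡 d) (φ.symm (η t)))‖ₑ ≤ c * ‖A u‖ₑ := by
      intro t ht
      obtain ⟨z, hz, hzt⟩ := hη t ht
      have := hs hz
      rw [Set.mem_preimage, hzt] at this
      refine ⟨this.1, fun u => ?_⟩
      have h2 := this.2.2 u
      rwa [φ.right_inv this.1] at h2
    have hηs : ContMDiffOn 𝓘(ℝ, ℝ) (𝓡 d) 1 η (Set.Icc 0 1) := by
      apply ContMDiff.contMDiffOn
      rw [contMDiff_iff_contDiff]
      exact ContinuousAffineMap.contDiff _
    have h1 : riemannianEDist (𝓡 d) x y ≤ pathELength (𝓡 d) (φ.symm ∘ η) 0 1 := by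
      apply riemannianEDist_le_pathELength _ _ _ zero_le_one
      · exact (contMDiffOn_extChartAt_symm p).comp hηs (fun t ht => (hη' t ht).1)
      · simp [η, ContinuousAffineMap.coe_lineMap_eq, φ, hx3]
      · simp [η, ContinuousAffineMap.coe_lineMap_eq, φ, hy3]
    apply h1.trans
    have e0 : edist (A (φ x)) (A (φ y)) = ∫⁻ t in Set.Icc (0 : ℝ) 1, ‖A (φ y - φ x)‖ₑ := by
      simp [edist_comm (A (φ x)), edist_eq_enorm_sub]
    rw [e0, pathELength_eq_lintegral_mfderivWithin_Icc,
      ← lintegral_const_mul' _ _ ENNReal.coe_ne_top]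
    apply setLIntegral_mono' measurableSet_Icc (fun t ht => ?_)
    have hu := uniqueDiffOn_Icc (zero_lt_one' ℝ) t ht
    have e1 : mfderivWithin 𝓘(ℝ, ℝ) (𝓡 d) (φ.symm ∘ η) (Set.Icc 0 1) t =
        (mfderivWithin (𝓡 d) (𝓡 d) φ.symm (Set.range (𝓡 d)) (η t)) ∘L
          (mfderivWithin 𝓘(ℝ, ℝ) (𝓡 d) η (Set.Icc 0 1) t) := by
      apply mfderivWithin_comp
      · exact mdifferentiableWithinAt_extChartAt_symm (hη' t ht).1
      · exact hηs.mdifferentiableOn one_ne_zero t ht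
      · exact fun t ht => extChartAt_target_subset_range p (hη' t ht).1
      · rw [uniqueMDiffWithinAt_iff_uniqueDiffWithinAt]; exact hu
    have e2 : mfderivWithin 𝓘(ℝ, ℝ) (𝓡 d) η (Set.Icc 0 1) t 1 = φ y - φ x := by
      rw [mfderivWithin_eq_fderivWithin, fderivWithin_eq_fderiv hu
        (ContinuousAffineMap.differentiableAt _)]
      simp only [η, ContinuousAffineMap.fderiv]
      change (AffineMap.lineMap (φ x) (φ y) : ℝ →ᵃ[ℝ] _).linear 1 = _
      simp
    have e3 : mfderivWithin 𝓘(ℝ, ℝ) (𝓡 d) (φ.symm ∘ η) (Set.Icc 0 1) t 1 =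
        (mfderivWithin (𝓡 d) (𝓡 d) φ.symm (Set.range (𝓡 d)) (η t))
          (mfderivWithin 𝓘(ℝ, ℝ) (𝓡 d) η (Set.Icc 0 1) t 1) := congrArg (fun L => L 1) e1
    rw [e3, e2]
    exact (hη' t ht).2 _

end Riemannian

/-! ### Lifting the measure of `G ⧸ Γ` to `G`; unimodularity -/

section Lattice

open MeasureTheory.Measure
open scoped Pointwise

variable {G : Type*} [TopologicalSpace G] [Group G] [IsTopologicalGroup G]

/-- The projection `G → G ⧸ Γ` by a discrete subgroup is injective near every point. -/
theorem exists_isOpen_injOn_mk (Γ : Subgroup G) [DiscreteTopology Γ] (g₀ : G) :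
    ∃ U : Set G, IsOpen U ∧ (1 : G) ∈ U ∧
      Set.InjOn (fun z : G => ((z * g₀ : G) : G ⧸ Γ)) U := by
  obtain ⟨O, hO, hO1⟩ : ∃ O : Set G, IsOpen O ∧ O ∩ Γ = {1} := by
    have := (isOpen_discrete ({1} : Set Γ))
    rw [isOpen_induced_iff] at this
    obtain ⟨O, hO, h⟩ := this
    refine ⟨O, hO, ?_⟩
    ext x
    constructor
    · rintro ⟨hx, hxΓ⟩
      have : (⟨x, hxΓ⟩ : Γ) ∈ Subtype.val ⁻¹' O := hx
      rw [h] at this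
      simpa using congrArg Subtype.val (Set.mem_singleton_iff.1 this)
    · rintro rfl
      have : (1 : Γ) ∈ Subtype.val ⁻¹' O := by rw [h]; rfl
      exact ⟨this, Γ.one_mem⟩
  have hcont : Continuous fun p : G × G => (p.1 * g₀)⁻¹ * (p.2 * g₀) := by fun_prop
  have hmem : (fun p : G × G => (p.1 * g₀)⁻¹ * (p.2 * g₀)) ⁻¹' O ∈ 𝓝 ((1 : G), (1 : G)) := by
    apply hcont.continuousAt.preimage_mem_nhds
    apply hO.mem_nhds
    have : (1 : G) ∈ O ∩ Γ := by rw [hO1]; rfl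
    simpa using this.1
  rw [nhds_prod_eq, Filter.mem_prod_same_iff] at hmem
  obtain ⟨t, ht, hsub⟩ := hmem
  obtain ⟨U, hUt, hU, h1⟩ := mem_nhds_iff.1 ht
  refine ⟨U, hU, h1, fun x hx y hy hxy => ?_⟩
  have h2 : (x * g₀)⁻¹ * (y * g₀) ∈ O ∩ Γ :=
    ⟨hsub (Set.mk_mem_prod (hUt hx) (hUt hy)), QuotientGroup.eq.1 hxy⟩
  rw [hO1, Set.mem_singleton_iff, inv_mul_eq_one] at h2
  exact mul_right_cancel h2

variable (Γ : Subgroup G)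

theorem isOpenEmbedding_mk_restrict {O : Set G} (hO : IsOpen O)
    (h : Set.InjOn (fun z : G => (z : G ⧸ Γ)) O) :
    Topology.IsOpenEmbedding (fun z : O => ((z : G) : G ⧸ Γ)) :=
  .of_continuous_injective_isOpenMap (QuotientGroup.continuous_mk.comp continuous_subtype_val)
    (Set.injOn_iff_injective.1 h) (QuotientGroup.isOpenMap_coe.comp hO.isOpenMap_subtype_val)

variable [DiscreteTopology Γ] [SecondCountableTopology G]

theorem exists_open_cover_injOn_mk : ∃ O : ℕ → Set G, (∀ i, IsOpen (O i)) ∧ ⋃ i, O i = Set.univ ∧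
    ∀ i, Set.InjOn (fun z : G => (z : G ⧸ Γ)) (O i) := by
  choose U hU h1 hinj using fun g₀ : G => exists_isOpen_injOn_mk Γ g₀
  let V : G → Set G := fun g => (fun z => z * g⁻¹) ⁻¹' U g
  have hV : ∀ g, IsOpen (V g) := fun g => (hU g).preimage (continuous_mul_const _)
  have hgV : ∀ g, g ∈ V g := fun g => by simpa [V] using h1 g
  obtain ⟨s, hs, hcov⟩ := TopologicalSpace.countable_cover_nhds fun g => (hV g).mem_nhds (hgV g)
  have hne : s.Nonempty := by
    by_contra h
    rw [Set.not_nonempty_iff_eq_empty] at h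
    simp [h] at hcov
    exact (Set.empty_ne_univ hcov).elim
  obtain ⟨e, rfl⟩ := hs.exists_eq_range hne
  refine ⟨fun i => V (e i), fun i => hV _, by simpa using hcov, fun i x hx y hy hxy => ?_⟩
  have := hinj (e i) hx hy (by simpa using hxy)
  exact mul_right_cancel this

variable [MeasurableSpace G] [BorelSpace G]

theorem exists_partition_injOn_mk : ∃ A : ℕ → Set G, (∀ i, MeasurableSet (A i)) ∧
    Pairwise (Function.onFun Disjoint A) ∧ ⋃ i, A i = Set.univ ∧
    ∀ i, ∃ O, A i ⊆ O ∧ IsOpen O ∧ Set.InjOn (fun z : G => (z : G ⧸ Γ)) O := by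
  obtain ⟨O, hO, hcov, hinj⟩ := exists_open_cover_injOn_mk Γ
  exact ⟨disjointed O, fun i => MeasurableSet.disjointed (fun i => (hO i).measurableSet) i,
    disjoint_disjointed O, by rw [iUnion_disjointed, hcov],
    fun i => ⟨O i, disjointed_subset O i, hO i, hinj i⟩⟩

theorem measure_ext_of_injOn_mk {ν ν' : Measure G}
    (h : ∀ B, MeasurableSet B → Set.InjOn (fun z : G => (z : G ⧸ Γ)) B → ν B = ν' B) :
    ν = ν' := by
  obtain ⟨A, hA, hdisj, hcov, hAO⟩ := exists_partition_injOn_mk Γ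
  ext B hB
  have e : B = ⋃ i, B ∩ A i := by rw [← Set.inter_iUnion, hcov, Set.inter_univ]
  have hd : Pairwise (Function.onFun Disjoint fun i => B ∩ A i) := fun i j hij =>
    (hdisj hij).mono Set.inter_subset_right Set.inter_subset_right
  rw [e, measure_iUnion hd fun i => hB.inter (hA i), measure_iUnion hd fun i => hB.inter (hA i)]
  congr 1
  ext i
  obtain ⟨O, hAO, -, hinj⟩ := hAO i
  exact h _ (hB.inter (hA i)) (hinj.mono (Set.inter_subset_right.trans hAO))

variable [MeasurableSpace (G ⧸ Γ)]

section Lift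

variable [BorelSpace (G ⧸ Γ)]

theorem measurableSet_image_mk {B : Set G} (hB : MeasurableSet B) :
    MeasurableSet ((fun z : G => (z : G ⧸ Γ)) '' B) := by
  obtain ⟨O, hO, hcov, hinj⟩ := exists_open_cover_injOn_mk Γ
  have : (fun z : G => (z : G ⧸ Γ)) '' B =
      ⋃ i, (fun z : O i => ((z : G) : G ⧸ Γ)) '' (Subtype.val ⁻¹' B) := by
    ext x
    simp only [Set.mem_image, Set.mem_iUnion, Set.mem_preimage, Subtype.exists]
    constructor
    · rintro ⟨z, hz, rfl⟩
      obtain ⟨i, hi⟩ := Set.mem_iUnion.1 (hcov.symm ▸ Set.mem_univ z)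
      exact ⟨i, z, hi, hz, rfl⟩
    · rintro ⟨i, z, hi, hz, rfl⟩
      exact ⟨z, hz, rfl⟩
  rw [this]
  exact MeasurableSet.iUnion fun i =>
    (isOpenEmbedding_mk_restrict Γ (hO i) (hinj i)).measurableEmbedding.measurableSet_image.2
      (measurable_subtype_coe hB)

/-- The lift of a measure on `G ⧸ Γ` to `G`, glued from the pieces of a countable Borel partition
on which the projection is injective. -/
theorem exists_lift_measure (μ : Measure (G ⧸ Γ)) : ∃ ν : Measure G,
    ∀ B, MeasurableSet B → Set.InjOn (fun z : G => (z : G ⧸ Γ)) B →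
      ν B = μ ((fun z : G => (z : G ⧸ Γ)) '' B) := by
  obtain ⟨A, hA, hdisj, hcov, hAO⟩ := exists_partition_injOn_mk Γ
  choose O hAO hO hinj using hAO
  refine ⟨Measure.sum fun i =>
    ((μ.comap (fun z : O i => ((z : G) : G ⧸ Γ))).map Subtype.val).restrict (A i), ?_⟩
  intro B hB hBinj
  rw [Measure.sum_apply _ hB]
  have h1 : ∀ i, (((μ.comap (fun z : O i => ((z : G) : G ⧸ Γ))).map Subtype.val).restrict (A i)) B
      = μ ((fun z : G => (z : G ⧸ Γ)) '' (B ∩ A i)) := by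
    intro i
    rw [Measure.restrict_apply hB, Measure.map_apply measurable_subtype_coe (hB.inter (hA i)),
      (isOpenEmbedding_mk_restrict Γ (hO i) (hinj i)).measurableEmbedding.comap_apply]
    congr 1
    ext x
    simp only [Set.mem_image, Set.mem_preimage, Subtype.exists]
    constructor
    · rintro ⟨z, _, hz, rfl⟩
      exact ⟨z, hz, rfl⟩
    · rintro ⟨z, hz, rfl⟩
      exact ⟨z, hAO i hz.2, hz, rfl⟩
  simp_rw [h1]
  rw [← measure_iUnion]
  · rw [← Set.image_iUnion, ← Set.inter_iUnion, hcov, Set.inter_univ]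
  · intro i j hij
    rw [Function.onFun, Set.disjoint_left]
    rintro _ ⟨x, hx, rfl⟩ ⟨y, hy, hxy⟩
    obtain rfl := hBinj hy.1 hx.1 hxy
    exact Set.disjoint_left.1 (hdisj hij) hx.2 hy.2
  · exact fun i => measurableSet_image_mk Γ (hB.inter (hA i))

end Lift

variable {Γ} {μ : Measure (G ⧸ Γ)} {ν : Measure G}

theorem isLocallyFiniteMeasure_of_lift [IsProbabilityMeasure μ]
    (hν : ∀ B, MeasurableSet B → Set.InjOn (fun z : G => (z : G ⧸ Γ)) B →
      ν B = μ ((fun z : G => (z : G ⧸ Γ)) '' B)) : IsLocallyFiniteMeasure ν := by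
  refine ⟨fun x => ?_⟩
  obtain ⟨O, hO, hcov, hinj⟩ := exists_open_cover_injOn_mk Γ
  obtain ⟨i, hi⟩ := Set.mem_iUnion.1 (hcov.symm ▸ Set.mem_univ x)
  refine ⟨O i, (hO i).mem_nhds hi, ?_⟩
  rw [hν _ (hO i).measurableSet (hinj i)]
  exact measure_lt_top _ _

theorem isMulLeftInvariant_of_lift [SMulInvariantMeasure G (G ⧸ Γ) μ]
    (hν : ∀ B, MeasurableSet B → Set.InjOn (fun z : G => (z : G ⧸ Γ)) B →
      ν B = μ ((fun z : G => (z : G ⧸ Γ)) '' B)) : ν.IsMulLeftInvariant := by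
  refine ⟨fun g => measure_ext_of_injOn_mk Γ fun B hB hinj => ?_⟩
  rw [Measure.map_apply (measurable_const_mul g) hB, hν B hB hinj, hν _ (measurable_const_mul g hB)]
  · have e : (fun z : G => (z : G ⧸ Γ)) '' ((g * ·) ⁻¹' B) =
        (g • ·) ⁻¹' ((fun z : G => (z : G ⧸ Γ)) '' B) := by
      ext x
      constructor
      · rintro ⟨z, hz, rfl⟩
        exact ⟨g * z, hz, rfl⟩
      · rintro ⟨z, hz, hzx⟩
        refine ⟨g⁻¹ * z, by simpa using hz, ?_⟩
        change g⁻¹ • ((z : G) : G ⧸ Γ) = x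
        rw [inv_smul_eq_iff]
        exact hzx
    rw [e, measure_preimage_smul]
  · intro x hx y hy hxy
    exact mul_left_cancel (hinj hx hy (congrArg (fun p : G ⧸ Γ => g • p) hxy))

theorem map_mul_right_of_lift (hν : ∀ B, MeasurableSet B →
      Set.InjOn (fun z : G => (z : G ⧸ Γ)) B → ν B = μ ((fun z : G => (z : G ⧸ Γ)) '' B))
    {γ : G} (hγ : γ ∈ Γ) : ν.map (· * γ) = ν := by
  have hq : ∀ z : G, ((z * γ : G) : G ⧸ Γ) = z := fun z => QuotientGroup.mk_mul_of_mem z hγ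
  refine measure_ext_of_injOn_mk Γ fun B hB hinj => ?_
  rw [Measure.map_apply (measurable_mul_const γ) hB, hν B hB hinj, hν _ (measurable_mul_const γ hB)]
  · congr 1
    ext x
    constructor
    · rintro ⟨z, hz, rfl⟩
      exact ⟨z * γ, hz, hq z⟩
    · rintro ⟨z, hz, rfl⟩
      refine ⟨z * γ⁻¹, by simpa using hz, ?_⟩
      exact QuotientGroup.mk_mul_of_mem z (Γ.inv_mem hγ)
  · intro x hx y hy hxy
    exact mul_right_cancel (hinj hx hy (by simpa only [hq] using hxy))

theorem isHaarMeasure_of_lift [LocallyCompactSpace G] [T2Space G] [IsProbabilityMeasure μ]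
    [SMulInvariantMeasure G (G ⧸ Γ) μ] [ν.Regular]
    (hν : ∀ B, MeasurableSet B → Set.InjOn (fun z : G => (z : G ⧸ Γ)) B →
      ν B = μ ((fun z : G => (z : G ⧸ Γ)) '' B)) : ν.IsHaarMeasure := by
  have := isMulLeftInvariant_of_lift hν
  have hne : NeZero ν := by
    refine ⟨fun h0 => ?_⟩
    obtain ⟨A, hA, hdisj, hcov, hAO⟩ := exists_partition_injOn_mk Γ
    have h1 : (Set.univ : Set (G ⧸ Γ)) ⊆ ⋃ i, (fun z : G => (z : G ⧸ Γ)) '' A i := by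
      rw [← Set.image_iUnion, hcov]
      intro x _
      obtain ⟨g, rfl⟩ := QuotientGroup.mk_surjective x
      exact ⟨g, trivial, rfl⟩
    have h2 : μ (⋃ i, (fun z : G => (z : G ⧸ Γ)) '' A i) = 0 := by
      rw [measure_iUnion_null_iff]
      intro i
      obtain ⟨O, hO, -, hinj⟩ := hAO i
      rw [← hν _ (hA i) (hinj.mono hO), h0]
      rfl
    have h3 := measure_mono_null h1 h2
    rw [measure_univ] at h3
    exact one_ne_zero h3
  have := isOpenPosMeasure_of_mulLeftInvariant_of_regular (μ := ν)
  exact {}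

variable [BorelSpace (G ⧸ Γ)]

theorem map_mul_right_eq_modularCharacterFun_smul [LocallyCompactSpace G] [ν.IsHaarMeasure]
    (g : G) : ν.map (· * g) = modularCharacterFun g • ν := by
  rw [modularCharacterFun_eq_haarScalarFactor ν g]
  exact isMulLeftInvariant_eq_smul _ ν

theorem exists_modularCharacterFun_le [LocallyCompactSpace G] [ν.IsHaarMeasure] {C : Set G}
    (hC : IsCompact C) : ∃ b : ℝ≥0, ∀ g ∈ C, modularCharacterFun g ≤ b := by
  obtain ⟨K, hK, hK1⟩ := exists_compact_mem_nhds (1 : G)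
  have hK0 : ν (interior K) ≠ 0 :=
    (isOpen_interior.measure_pos ν ⟨1, mem_interior_iff_mem_nhds.2 hK1⟩).ne'
  have hfin : ν (K * C⁻¹) ≠ ⊤ := (hK.mul hC.inv).measure_lt_top.ne
  refine ⟨(ν (K * C⁻¹) / ν (interior K)).toNNReal, fun g hg => ?_⟩
  rw [← ENNReal.coe_le_coe, ENNReal.coe_toNNReal (ENNReal.div_ne_top hfin hK0),
    ENNReal.le_div_iff_mul_le (Or.inl hK0) (Or.inl (measure_ne_top_of_subset interior_subset
      hK.measure_lt_top.ne))]
  calc (modularCharacterFun g : ℝ≥0∞) * ν (interior K)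
      = (modularCharacterFun g • ν) (interior K) := rfl
    _ = ν ((· * g) ⁻¹' interior K) := by
        rw [← map_mul_right_eq_modularCharacterFun_smul,
          Measure.map_apply (measurable_mul_const g) isOpen_interior.measurableSet]
    _ ≤ ν (K * C⁻¹) := by
        refine measure_mono fun x hx => ?_
        exact ⟨x * g, interior_subset hx, g⁻¹, by simpa using hg, by simp⟩

/-- A group containing a lattice is unimodular: by Poincaré recurrence some power of `h` carries a
point of a small set back to that set modulo `Γ`, where the modular character is trivial, so the
powers of `Δ h` cannot escape to infinity. -/
theorem modularCharacterFun_eq_one_of_lift [LocallyCompactSpace G] [ν.IsHaarMeasure]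
    [IsProbabilityMeasure μ] [SMulInvariantMeasure G (G ⧸ Γ) μ]
    (hν : ∀ B, MeasurableSet B → Set.InjOn (fun z : G => (z : G ⧸ Γ)) B →
      ν B = μ ((fun z : G => (z : G ⧸ Γ)) '' B)) (h : G) : modularCharacterFun h = 1 := by
  have hΓ : ∀ γ ∈ Γ, modularCharacterFun γ = 1 := fun γ hγ => by
    rw [modularCharacterFun_eq_haarScalarFactor ν]
    simp only [map_mul_right_of_lift hν hγ, haarScalarFactor_self]
  suffices H : ∀ h : G, modularCharacterFun h ≤ 1 by
    refine le_antisymm (H h) ?_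
    have h1 : modularCharacterFun h * modularCharacterFun h⁻¹ = 1 := by
      rw [← modularCharacterFun_map_mul, mul_inv_cancel, modularCharacterFun_map_one]
    calc (1 : ℝ≥0) = modularCharacterFun h * modularCharacterFun h⁻¹ := h1.symm
      _ ≤ modularCharacterFun h * 1 := by gcongr; exact H _
      _ = _ := mul_one _
  intro h
  by_contra! hcon
  obtain ⟨C, hC, hC1⟩ := exists_compact_mem_nhds (1 : G)
  obtain ⟨U, hU, hU1, hinj⟩ := exists_isOpen_injOn_mk Γ 1
  let V := U ∩ interior C
  have hV : IsOpen V := hU.inter isOpen_interior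
  have hV1 : (1 : G) ∈ V := ⟨hU1, mem_interior_iff_mem_nhds.2 hC1⟩
  have hVinj : Set.InjOn (fun z : G => (z : G ⧸ Γ)) V := fun x hx y hy hxy =>
    hinj hx.1 hy.1 (by simpa using hxy)
  have hVpos : μ ((fun z : G => (z : G ⧸ Γ)) '' V) ≠ 0 := by
    rw [← hν V hV.measurableSet hVinj]
    exact (hV.measure_pos ν ⟨1, hV1⟩).ne'
  obtain ⟨b, hb⟩ := exists_modularCharacterFun_le (ν := ν) hC
  obtain ⟨b', hb'⟩ := exists_modularCharacterFun_le (ν := ν) hC.inv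
  obtain ⟨n, hn⟩ := pow_unbounded_of_one_lt (b * b') hcon
  have hcons := (measurePreserving_smul (h ^ n) μ).conservative
  obtain ⟨x, hx, m, hm, hmx⟩ := hcons.exists_mem_iterate_mem
    (measurableSet_image_mk Γ hV.measurableSet).nullMeasurableSet hVpos
  obtain ⟨v, hv, rfl⟩ := hx
  obtain ⟨v', hv', hvv'⟩ := hmx
  rw [smul_iterate] at hvv'
  change ((v' : G) : G ⧸ Γ) = (((h ^ n) ^ m * v : G) : G ⧸ Γ) at hvv'
  have h2 := hΓ _ (QuotientGroup.eq.1 hvv'.symm)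
  have h3 : (modularCharacterFun h ^ n) ^ m = modularCharacterFun v' * modularCharacterFun v⁻¹ := by
    have hpow : ∀ j : ℕ, ∀ g : G, modularCharacterFun (g ^ j) = modularCharacterFun g ^ j :=
      fun j g => map_pow (modularCharacter (G := G)) g j
    have e : v' = (h ^ n) ^ m * v * (((h ^ n) ^ m * v)⁻¹ * v') := by group
    rw [← hpow, ← hpow]
    conv_rhs => rw [e, modularCharacterFun_map_mul, h2, mul_one, modularCharacterFun_map_mul,
      mul_assoc, ← modularCharacterFun_map_mul, mul_inv_cancel, modularCharacterFun_map_one,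
      mul_one]
  have h4 : (modularCharacterFun h ^ n) ^ m ≤ b * b' := by
    rw [h3]
    exact mul_le_mul' (hb _ (interior_subset hv'.2))
      (hb' _ (Set.inv_mem_inv.2 (interior_subset hv.2)))
  have h5 : modularCharacterFun h ^ n ≤ (modularCharacterFun h ^ n) ^ m :=
    le_self_pow₀ (one_le_pow₀ hcon.le) hm
  exact (hn.trans_le (h5.trans h4)).false

theorem isMulRightInvariant_of_lift [LocallyCompactSpace G] [ν.IsHaarMeasure]
    [IsProbabilityMeasure μ] [SMulInvariantMeasure G (G ⧸ Γ) μ]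
    (hν : ∀ B, MeasurableSet B → Set.InjOn (fun z : G => (z : G ⧸ Γ)) B →
      ν B = μ ((fun z : G => (z : G ⧸ Γ)) '' B)) : ν.IsMulRightInvariant :=
  ⟨fun g => by rw [map_mul_right_eq_modularCharacterFun_smul,
    modularCharacterFun_eq_one_of_lift hν, one_smul]⟩

/-- A right-invariant measure is a multiple of a bi-invariant Haar measure. -/
theorem exists_eq_smul_of_isMulRightInvariant [LocallyCompactSpace G] [ν.IsHaarMeasure]
    [ν.IsMulRightInvariant] (ν' : Measure G) [IsFiniteMeasureOnCompacts ν']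
    [ν'.IsMulRightInvariant] : ∃ c : ℝ≥0, ν' = c • ν := by
  obtain ⟨c, h1⟩ : ∃ c : ℝ≥0, ν'.inv = c • ν := ⟨_, isMulLeftInvariant_eq_smul _ ν⟩
  obtain ⟨c', h2⟩ : ∃ c : ℝ≥0, ν.inv = c • ν := ⟨_, isMulLeftInvariant_eq_smul _ ν⟩
  refine ⟨c * c', ?_⟩
  rw [mul_smul, ← h2]
  ext s hs
  rw [← inv_inv s, ← Measure.inv_apply, h1]
  simp [Measure.inv_apply]

end Lattice

/-! ### Right-invariant metrics and their Hausdorff measure -/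

section InvariantMetric

open MeasureTheory.Measure

variable {d : ℕ} {G : Type*} [TopologicalSpace G] [ChartedSpace (EuclideanSpace ℝ (Fin d)) G]
  [Group G] [LieGroup (𝓡 d) ∞ G]

theorem contMDiff_mul_right_lie (h : G) {n : ℕ∞ω} (hn : n ≤ (∞ : ℕ∞ω)) :
    ContMDiff (𝓡 d) (𝓡 d) n (fun y : G => y * h) :=
  (contMDiff_mul_right (I := 𝓡 d) (n := ∞) (a := h)).of_le hn

variable [RiemannianBundle (fun x : G => TangentSpace (𝓡 d) x)]

theorem riemannianEDist_mul_right (hmetric : IsRightInvariantMetric d G) (x y h : G) :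
    riemannianEDist (𝓡 d) (x * h) (y * h) = riemannianEDist (𝓡 d) x y := by
  have hle : ∀ x y h : G, riemannianEDist (𝓡 d) (x * h) (y * h) ≤ riemannianEDist (𝓡 d) x y := by
    intro x y h
    apply le_of_forall_gt (fun r hr => ?_)
    obtain ⟨γ, h0, h1, hγ, hlen⟩ := exists_lt_of_riemannianEDist_lt hr
    have hR := contMDiff_mul_right_lie (d := d) h (n := 1) (by norm_num)
    refine lt_of_le_of_lt (riemannianEDist_le_pathELength (γ := fun t => γ t * h) (a := 0) (b := 1)
      (hR.comp_contMDiffOn hγ) (by simp [h0]) (by simp [h1]) zero_le_one) ?_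
    refine lt_of_le_of_lt (le_of_eq ?_) hlen
    rw [pathELength_eq_lintegral_mfderivWithin_Icc, pathELength_eq_lintegral_mfderivWithin_Icc]
    apply setLIntegral_congr_fun measurableSet_Icc (fun t ht => ?_)
    have hu := uniqueDiffOn_Icc (zero_lt_one' ℝ) t ht
    have e1 : mfderivWithin 𝓘(ℝ, ℝ) (𝓡 d) ((fun z => z * h) ∘ γ) (Set.Icc 0 1) t =
        (mfderiv (𝓡 d) (𝓡 d) (· * h) (γ t)) ∘L
          (mfderivWithin 𝓘(ℝ, ℝ) (𝓡 d) γ (Set.Icc 0 1) t) := by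
      apply mfderiv_comp_mfderivWithin
      · exact hR.mdifferentiable one_ne_zero _
      · exact hγ.mdifferentiableOn one_ne_zero _ ht
      · rw [uniqueMDiffWithinAt_iff_uniqueDiffWithinAt]; exact hu
    have e2 : mfderivWithin 𝓘(ℝ, ℝ) (𝓡 d) (fun t => γ t * h) (Set.Icc 0 1) t 1 =
        (mfderiv (𝓡 d) (𝓡 d) (· * h) (γ t))
          (mfderivWithin 𝓘(ℝ, ℝ) (𝓡 d) γ (Set.Icc 0 1) t 1) := congrArg (fun L => L 1) e1
    have hnorm : ∀ (z : G) (v : TangentSpace (𝓡 d) z),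
        ‖mfderiv (𝓡 d) (𝓡 d) (· * h) z v‖ₑ = ‖v‖ₑ := by
      intro z v
      rw [← ofReal_norm, ← ofReal_norm, norm_eq_sqrt_real_inner, norm_eq_sqrt_real_inner,
        hmetric z h v v]
    change ‖mfderivWithin 𝓘(ℝ, ℝ) (𝓡 d) (fun t => γ t * h) (Set.Icc 0 1) t 1‖ₑ = _
    rw [e2]
    exact hnorm _ _
  refine le_antisymm (hle x y h) ?_
  simpa using hle (x * h) (y * h) h⁻¹

/-- Balls in `G ⧸ Γ` are projections of right translates of balls at the identity of `G`. -/
theorem setOf_homEDist_lt (hmetric : IsRightInvariantMetric d G) {Γ : Subgroup G} (g₀ : G)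
    (r : ℝ≥0∞) : {x : G ⧸ Γ | homEDist d x g₀ < r} =
      (fun z : G => ((z * g₀ : G) : G ⧸ Γ)) '' {z | riemannianEDist (𝓡 d) z 1 < r} := by
  ext x
  simp only [homEDist, Set.mem_ofPred_eq, iInf_lt_iff, Set.mem_image]
  constructor
  · rintro ⟨g, h, rfl, hh, hlt⟩
    refine ⟨g * h⁻¹, ?_, ?_⟩
    · rw [← riemannianEDist_mul_right hmetric _ _ h]
      simpa using hlt
    · rw [QuotientGroup.eq]
      have := QuotientGroup.eq.1 hh
      have e : (g * h⁻¹ * g₀)⁻¹ * g = (h⁻¹ * g₀)⁻¹ := by group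
      rw [e]
      exact Γ.inv_mem this
  · rintro ⟨z, hz, rfl⟩
    refine ⟨z * g₀, g₀, rfl, rfl, ?_⟩
    rw [← riemannianEDist_mul_right hmetric _ _ g₀] at hz
    simpa using hz

variable [IsContMDiffRiemannianBundle (𝓡 d) ∞ (EuclideanSpace ℝ (Fin d))
      (fun x : G => TangentSpace (𝓡 d) x)]

variable (d G) in
theorem isContinuousRiemannianBundle_of_contMDiff :
    IsContinuousRiemannianBundle (EuclideanSpace ℝ (Fin d))
      (fun x : G => TangentSpace (𝓡 d) x) := by
  obtain ⟨g, hg, h⟩ := IsContMDiffRiemannianBundle.exists_contMDiff (IB := 𝓡 d) (n := ∞)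
    (F := EuclideanSpace ℝ (Fin d)) (E := fun x : G => TangentSpace (𝓡 d) x)
  exact ⟨g, hg.continuous, h⟩

/-- The Hausdorff measure of the Riemannian metric is right-invariant, and as the metric is
infinitesimally Euclidean, the measure of small balls is asymptotically that of Euclidean balls. -/
theorem exists_isMulRightInvariant_tendsto_ball [T3Space G]
    [MeasurableSpace G] [BorelSpace G] (hmetric : IsRightInvariantMetric d G) :
    ∃ H : Measure G, H.IsMulRightInvariant ∧ IsLocallyFiniteMeasure H ∧ ∃ κ : ℝ, 0 < κ ∧
      Tendsto (fun R : ℝ => H.real {z | riemannianEDist (𝓡 d) z 1 < ENNReal.ofReal R} / R ^ d)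
        (𝓝[>] 0) (𝓝 κ) := by
  have := isContinuousRiemannianBundle_of_contMDiff d G
  have htop : IsTopologicalGroup G := topologicalGroup_of_lieGroup (𝓡 d) ∞
  let em : EMetricSpace G := .ofRiemannianMetric (𝓡 d) G
  have hed : ∀ x y : G, edist x y = riemannianEDist (𝓡 d) x y := fun x y => rfl
  have hiso : IsIsometricSMul Gᵐᵒᵖ G := ⟨fun c x y => by
    rw [hed, hed]; exact riemannianEDist_mul_right hmetric x y c.unop⟩
  let H : Measure G := μH[d]
  let HE : Measure (EuclideanSpace ℝ (Fin d)) := μH[d]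
  have hHE : HE.IsAddHaarMeasure := by
    have := isAddHaarMeasure_hausdorffMeasure (E := EuclideanSpace ℝ (Fin d))
    rwa [finrank_euclideanSpace_fin] at this
  set κ : ℝ := HE.real (Metric.ball 0 1) with hκ
  have hκpos : 0 < κ := by
    rw [hκ, measureReal_def]
    exact ENNReal.toReal_pos (Metric.measure_ball_pos _ _ one_pos).ne' measure_ball_lt_top.ne
  have hball : ∀ (x : EuclideanSpace ℝ (Fin d)) (s : ℝ), 0 < s →
      HE (Metric.ball x s) = ENNReal.ofReal (s ^ d * κ) := by
    intro x s hs
    rw [addHaar_ball_of_pos HE x hs, finrank_euclideanSpace_fin,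
      ENNReal.ofReal_mul (by positivity), hκ, ofReal_measureReal measure_ball_lt_top.ne]
  obtain ⟨A, hA⟩ := exists_chart_almost_isometric (d := d) (1 : G)
  set φ := extChartAt (𝓡 d) (1 : G) with hφ
  -- two-sided comparison on balls of small radius
  have hcomp : ∀ c : ℝ≥0, 1 < c → ∀ᶠ R : ℝ in 𝓝[>] 0,
      H {z | riemannianEDist (𝓡 d) z 1 < ENNReal.ofReal R} ≤
        ENNReal.ofReal ((c : ℝ) ^ (2 * d) * R ^ d * κ) ∧
      ENNReal.ofReal (R ^ d * κ) ≤ ENNReal.ofReal ((c : ℝ) ^ (2 * d)) *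
        H {z | riemannianEDist (𝓡 d) z 1 < ENNReal.ofReal R} := by
    intro c hc
    have hc0 : (0 : ℝ) < c := by exact_mod_cast zero_lt_one.trans hc
    obtain ⟨U₀, hU₀, hU₀d⟩ := hA c hc
    have hU : U₀ ∩ φ.source ∈ 𝓝 (1 : G) := inter_mem hU₀ (extChartAt_source_mem_nhds 1)
    obtain ⟨r, hr, hrU⟩ := Metric.nhds_basis_eball.mem_iff.1 hU
    have hV : A.symm ⁻¹' (φ.target ∩ φ.symm ⁻¹' (U₀ ∩ φ.source)) ∈ 𝓝 (A (φ 1)) := by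
      apply A.symm.continuous.continuousAt.preimage_mem_nhds
      rw [A.symm_apply_apply]
      exact inter_mem (extChartAt_target_mem_nhds 1)
        ((continuousAt_extChartAt_symm (1 : G)).preimage_mem_nhds (by rwa [extChartAt_to_inv]))
    obtain ⟨s, hs, hsV⟩ := Metric.mem_nhds_iff.1 hV
    have hev : ∀ᶠ R : ℝ in 𝓝[>] 0, 0 < R ∧ ENNReal.ofReal R < r ∧ R / c < s := by
      refine eventually_mem_nhdsWithin.and (Filter.Eventually.and ?_ ?_)
      · have : Tendsto ENNReal.ofReal (𝓝[>] 0) (𝓝 (ENNReal.ofReal 0)) :=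
          (ENNReal.continuous_ofReal.tendsto 0).mono_left nhdsWithin_le_nhds
        exact this.eventually_lt_const (by simpa using hr)
      · have : Tendsto (fun R : ℝ => R / c) (𝓝[>] 0) (𝓝 (0 / c)) :=
          ((continuous_id.div_const _).tendsto 0).mono_left nhdsWithin_le_nhds
        exact this.eventually_lt_const (by simpa using hs)
    filter_upwards [hev] with R ⟨hR0, hRr, hRs⟩
    set B := {z | riemannianEDist (𝓡 d) z (1 : G) < ENNReal.ofReal R} with hB
    have hBU : B ⊆ U₀ ∩ φ.source := fun z hz => hrU (lt_trans hz hRr)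
    have h1U : (1 : G) ∈ U₀ := mem_of_mem_nhds hU₀
    have hedist : ∀ u v : EuclideanSpace ℝ (Fin d), edist u v = ENNReal.ofReal (dist u v) :=
      fun u v => edist_dist u v
    constructor
    · have hlip : LipschitzOnWith c (φ.symm ∘ A.symm) ((A ∘ φ) '' B) := by
        rintro _ ⟨x, hx, rfl⟩ _ ⟨y, hy, rfl⟩
        simp only [Function.comp_apply, A.symm_apply_apply, φ.left_inv (hBU hx).2,
          φ.left_inv (hBU hy).2]
        exact (hU₀d x (hBU hx).1 y (hBU hy).1).2
      have himg : (φ.symm ∘ A.symm) '' ((A ∘ φ) '' B) = B := by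
        rw [← Set.image_comp]
        conv_rhs => rw [← Set.image_id B]
        refine Set.image_congr fun x hx => ?_
        simp [φ.left_inv (hBU hx).2]
      have hsub : (A ∘ φ) '' B ⊆ Metric.ball (A (φ 1)) (c * R) := by
        rintro _ ⟨x, hx, rfl⟩
        have h1 := (hU₀d x (hBU hx).1 1 h1U).1
        have h2 : (c : ℝ≥0∞) * riemannianEDist (𝓡 d) x 1 < ENNReal.ofReal (c * R) := by
          rw [ENNReal.ofReal_mul hc0.le, ENNReal.ofReal_coe_nnreal]
          exact ENNReal.mul_lt_mul_right (by simpa using (zero_lt_one.trans hc).ne') (by simp) hx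
        have h3 := h1.trans_lt h2
        rw [hedist] at h3
        exact (ENNReal.ofReal_lt_ofReal_iff (by positivity)).1 h3
      calc H B = H ((φ.symm ∘ A.symm) '' ((A ∘ φ) '' B)) := by rw [himg]
        _ ≤ (c : ℝ≥0∞) ^ (d : ℝ) * HE ((A ∘ φ) '' B) := hlip.hausdorffMeasure_image_le (by simp)
        _ ≤ (c : ℝ≥0∞) ^ (d : ℝ) * HE (Metric.ball (A (φ 1)) (c * R)) := by gcongr
        _ = ENNReal.ofReal ((c : ℝ) ^ (2 * d) * R ^ d * κ) := by
          rw [hball _ _ (by positivity), ENNReal.rpow_natCast, ← ENNReal.ofReal_coe_nnreal,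
            ← ENNReal.ofReal_pow hc0.le, ← ENNReal.ofReal_mul (by positivity)]
          congr 1; ring
    · have hlip : LipschitzOnWith c (A ∘ φ) B := fun x hx y hy =>
        (hU₀d x (hBU hx).1 y (hBU hy).1).1
      have hsub : Metric.ball (A (φ 1)) (R / c) ⊆ (A ∘ φ) '' B := by
        intro u hu
        have hu' := hsV (Metric.ball_subset_ball hRs.le hu)
        refine ⟨φ.symm (A.symm u), ?_, by simp [φ.right_inv hu'.1]⟩
        have h1 := (hU₀d _ hu'.2.1 1 h1U).2
        rw [φ.right_inv hu'.1, A.apply_symm_apply, hedist] at h1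
        refine h1.trans_lt ?_
        rw [← ENNReal.ofReal_coe_nnreal, ← ENNReal.ofReal_mul hc0.le]
        refine (ENNReal.ofReal_lt_ofReal_iff hR0).2 ?_
        rw [Metric.mem_ball, lt_div_iff₀ hc0] at hu
        linarith
      have key : HE (Metric.ball (A (φ 1)) (R / c)) ≤ (c : ℝ≥0∞) ^ (d : ℝ) * H B :=
        (measure_mono hsub).trans (hlip.hausdorffMeasure_image_le (by simp))
      rw [hball _ _ (by positivity), ENNReal.rpow_natCast, ← ENNReal.ofReal_coe_nnreal,
            ← ENNReal.ofReal_pow hc0.le] at key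
      calc ENNReal.ofReal (R ^ d * κ)
          = ENNReal.ofReal ((c : ℝ) ^ d) * ENNReal.ofReal ((R / c) ^ d * κ) := by
            rw [← ENNReal.ofReal_mul (by positivity)]
            congr 1
            rw [div_pow]
            field_simp
        _ ≤ ENNReal.ofReal ((c : ℝ) ^ d) * (ENNReal.ofReal ((c : ℝ) ^ d) * H B) := by gcongr
        _ = _ := by
            rw [← mul_assoc, ← ENNReal.ofReal_mul (by positivity)]
            congr 2; ring
  refine ⟨H, inferInstance, ?_, κ, hκpos, ?_⟩
  · refine ⟨fun x => ?_⟩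
    obtain ⟨R, hR, hR0⟩ := ((hcomp 2 one_lt_two).and eventually_mem_nhdsWithin).exists
    refine ⟨(· * x⁻¹) ⁻¹' {z | riemannianEDist (𝓡 d) z 1 < ENNReal.ofReal R}, ?_, ?_⟩
    · apply (continuous_mul_const x⁻¹).continuousAt.preimage_mem_nhds
      rw [mul_inv_cancel]
      exact Metric.eball_mem_nhds 1 (by simpa using hR0)
    · rw [measure_preimage_mul_right]
      exact hR.1.trans_lt ENNReal.ofReal_lt_top
  · have hbounds : ∀ c : ℝ≥0, 1 < c → ∀ᶠ R : ℝ in 𝓝[>] 0,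
        H.real {z | riemannianEDist (𝓡 d) z 1 < ENNReal.ofReal R} / R ^ d ≤ (c : ℝ) ^ (2 * d) * κ ∧
        κ / (c : ℝ) ^ (2 * d) ≤
          H.real {z | riemannianEDist (𝓡 d) z 1 < ENNReal.ofReal R} / R ^ d := by
      intro c hc
      have hc0 : (0 : ℝ) < c := by exact_mod_cast zero_lt_one.trans hc
      filter_upwards [hcomp c hc, eventually_mem_nhdsWithin] with R ⟨h1, h2⟩ hR
      have hR : 0 < R := hR
      have hfin := (h1.trans_lt ENNReal.ofReal_lt_top).ne
      rw [← ofReal_measureReal hfin, ENNReal.ofReal_le_ofReal_iff (by positivity)] at h1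
      rw [← ofReal_measureReal hfin, ← ENNReal.ofReal_mul (by positivity),
        ENNReal.ofReal_le_ofReal_iff (by positivity)] at h2
      rw [div_le_iff₀ (by positivity), div_le_div_iff₀ (by positivity) (by positivity)]
      constructor <;> linarith
    have hlim1 : Tendsto (fun c : ℝ≥0 => (c : ℝ) ^ (2 * d) * κ) (𝓝[>] 1) (𝓝 κ) := by
      have : Continuous fun c : ℝ≥0 => (c : ℝ) ^ (2 * d) * κ := by fun_prop
      simpa using (this.tendsto 1).mono_left nhdsWithin_le_nhds
    have hlim2 : Tendsto (fun c : ℝ≥0 => κ / (c : ℝ) ^ (2 * d)) (𝓝[>] 1) (𝓝 κ) := by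
      have : ContinuousAt (fun c : ℝ≥0 => κ / (c : ℝ) ^ (2 * d)) 1 := by
        exact ContinuousAt.div continuousAt_const (by fun_prop) (by simp)
      simpa using this.tendsto.mono_left nhdsWithin_le_nhds
    refine tendsto_order.2 ⟨fun a ha => ?_, fun a ha => ?_⟩
    · obtain ⟨c, hc, hc1⟩ := ((hlim2.eventually_const_lt ha).and eventually_mem_nhdsWithin).exists
      filter_upwards [hbounds c hc1] with R hR using hc.trans_le hR.2
    · obtain ⟨c, hc, hc1⟩ := ((hlim1.eventually_lt_const ha).and eventually_mem_nhdsWithin).exists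
      filter_upwards [hbounds c hc1] with R hR using hR.1.trans_lt hc

end InvariantMetric

/-! ### The measure of small balls in `G ⧸ Γ` -/

section BallMeasure

variable {d : ℕ} {G : Type*} [TopologicalSpace G] [ChartedSpace (EuclideanSpace ℝ (Fin d)) G]
  [Group G] [LieGroup (𝓡 d) ∞ G] [RiemannianBundle (fun x : G => TangentSpace (𝓡 d) x)]
  [IsContMDiffRiemannianBundle (𝓡 d) ∞ (EuclideanSpace ℝ (Fin d))
      (fun x : G => TangentSpace (𝓡 d) x)]

theorem isOpen_setOf_riemannianEDist_lt [T3Space G] (r : ℝ≥0∞) :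
    IsOpen {z : G | riemannianEDist (𝓡 d) z 1 < r} := by
  have := isContinuousRiemannianBundle_of_contMDiff d G
  let em : EMetricSpace G := .ofRiemannianMetric (𝓡 d) G
  exact Metric.isOpen_eball (x := (1 : G)) (ε := r)

theorem exists_setOf_riemannianEDist_lt_subset [T3Space G] {U : Set G} (hU : U ∈ 𝓝 1) :
    ∃ r : ℝ, 0 < r ∧ {z : G | riemannianEDist (𝓡 d) z 1 < ENNReal.ofReal r} ⊆ U := by
  have := isContinuousRiemannianBundle_of_contMDiff d G
  obtain ⟨c, hc, h⟩ := setOfPred_riemannianEDist_lt_subset_nhds (𝓡 d) hU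
  refine ⟨c, hc, fun z hz => h ?_⟩
  rw [Set.mem_ofPred_eq, riemannianEDist_comm]
  simpa using hz

theorem isOpen_setOf_homEDist_lt [T3Space G] (hmetric : IsRightInvariantMetric d G)
    (Γ : Subgroup G) (x₀ : G ⧸ Γ) (r : ℝ≥0∞) : IsOpen {x | homEDist d x x₀ < r} := by
  have htop : IsTopologicalGroup G := topologicalGroup_of_lieGroup (𝓡 d) ∞
  obtain ⟨g₀, rfl⟩ := QuotientGroup.mk_surjective x₀
  rw [setOf_homEDist_lt hmetric]
  exact (QuotientGroup.isOpenMap_coe.comp (isOpenMap_mul_right g₀)) _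
    (isOpen_setOf_riemannianEDist_lt r)

/-- The measure of a small ball in `G ⧸ Γ` is asymptotically that of a Euclidean ball, with a
density that does not depend on the centre. -/
theorem exists_tendsto_measure_homEDist_lt [T2Space G] [SecondCountableTopology G]
    (hmetric : IsRightInvariantMetric d G) (Γ : Subgroup G) [DiscreteTopology Γ]
    [MeasurableSpace (G ⧸ Γ)] [BorelSpace (G ⧸ Γ)] (μ : Measure (G ⧸ Γ)) [IsProbabilityMeasure μ]
    [SMulInvariantMeasure G (G ⧸ Γ) μ] :
    ∃ w : ℝ, 0 < w ∧ ∀ x₀ : G ⧸ Γ,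
      Tendsto (fun R : ℝ => μ.real {x | homEDist d x x₀ < ENNReal.ofReal R} / R ^ d)
        (𝓝[>] 0) (𝓝 w) := by
  have htop : IsTopologicalGroup G := topologicalGroup_of_lieGroup (𝓡 d) ∞
  have hloc : LocallyCompactSpace G := Manifold.locallyCompact_of_finiteDimensional (𝓡 d)
  borelize G
  obtain ⟨ν, hν⟩ := exists_lift_measure Γ μ
  have hνfin := isLocallyFiniteMeasure_of_lift hν
  have hνHaar := isHaarMeasure_of_lift hν
  have hνright := isMulRightInvariant_of_lift hν
  obtain ⟨H, hHright, hHfin, κ, hκ, hlim⟩ :=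
    exists_isMulRightInvariant_tendsto_ball (d := d) (G := G) hmetric
  obtain ⟨c, rfl⟩ := exists_eq_smul_of_isMulRightInvariant (ν := ν) H
  have hc : (c : ℝ) ≠ 0 := by
    intro hc
    have hc : c = 0 := by exact_mod_cast hc
    simp only [hc, zero_smul, measureReal_zero, Pi.zero_apply, zero_div] at hlim
    exact hκ.ne' (tendsto_nhds_unique hlim tendsto_const_nhds)
  have hcpos : (0 : ℝ) < c := lt_of_le_of_ne c.2 hc.symm
  refine ⟨κ / c, by positivity, fun x₀ => ?_⟩
  obtain ⟨g₀, rfl⟩ := QuotientGroup.mk_surjective x₀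
  obtain ⟨U, hU, hU1, hinj⟩ := exists_isOpen_injOn_mk Γ g₀
  obtain ⟨r, hr, hrU⟩ := exists_setOf_riemannianEDist_lt_subset (d := d) (hU.mem_nhds hU1)
  refine (hlim.div_const (c : ℝ)).congr' ?_
  filter_upwards [Ioo_mem_nhdsGT hr] with R hR
  set B := {z : G | riemannianEDist (𝓡 d) z 1 < ENNReal.ofReal R} with hB
  have hBU : B ⊆ U := fun z hz => hrU (lt_of_lt_of_le hz (ENNReal.ofReal_le_ofReal hR.2.le))
  have hBm : MeasurableSet B := (isOpen_setOf_riemannianEDist_lt _).measurableSet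
  have himg : {x : G ⧸ Γ | homEDist d x g₀ < ENNReal.ofReal R} =
      (fun z : G => (z : G ⧸ Γ)) '' ((· * g₀⁻¹) ⁻¹' B) := by
    rw [setOf_homEDist_lt hmetric]
    ext x
    constructor
    · rintro ⟨z, hz, rfl⟩
      exact ⟨z * g₀, by rwa [Set.mem_preimage, mul_inv_cancel_right], rfl⟩
    · rintro ⟨z, hz, rfl⟩
      exact ⟨z * g₀⁻¹, hz, by simp⟩
  have hval : μ {x : G ⧸ Γ | homEDist d x g₀ < ENNReal.ofReal R} = ν B := by
    rw [himg, ← hν _ (measurable_mul_const _ hBm), measure_preimage_mul_right]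
    intro x hx y hy hxy
    exact mul_right_cancel (hinj (hBU hx) (hBU hy) (by simpa using hxy))
  rw [measureReal_def, measureReal_def, hval]
  simp only [Measure.smul_apply, ENNReal.toReal_smul]
  rw [NNReal.smul_def, smul_eq_mul]
  field_simp

end BallMeasure

/-! ### Derivatives along right-invariant vector fields -/

section RightInvariantDeriv

variable {d : ℕ} {G : Type*} [TopologicalSpace G] [ChartedSpace (EuclideanSpace ℝ (Fin d)) G]
  [Group G]
  {V : Type*} [NormedAddCommGroup V] [NormedSpace ℝ V]

/-- The derivative of `F` along the right-invariant vector field that equals `v` at the identity, so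
that `rightInvDeriv v F z` is the derivative of `F (exp (t v) z)` at `t = 0`. -/
noncomputable def rightInvDeriv (v : LieAlg d G) (F : G → V) (z : G) : V :=
  mfderiv (𝓡 d) 𝓘(ℝ, V) (fun h => F (h * z)) 1 v

theorem rightInvDeriv_smul (s : ℝ) (v : LieAlg d G) (F : G → V) (z : G) :
    rightInvDeriv (s • v) F z = s • rightInvDeriv v F z :=
  (mfderiv (𝓡 d) 𝓘(ℝ, V) (fun h => F (h * z)) 1).map_smul s v

variable [LieGroup (𝓡 d) ∞ G]

theorem mdifferentiableAt_comp_mul_right {F : G → V} {z : G}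
    (hF : MDifferentiableAt (𝓡 d) 𝓘(ℝ, V) F z) :
    MDifferentiableAt (𝓡 d) 𝓘(ℝ, V) (fun h => F (h * z)) 1 := by
  have h1 : MDifferentiableAt (𝓡 d) (𝓡 d) (fun h : G => h * z) 1 :=
    (contMDiff_mul_right_lie z (n := 1) (by norm_num)).mdifferentiable one_ne_zero 1
  have hF' : MDifferentiableAt (𝓡 d) 𝓘(ℝ, V) F ((fun h : G => h * z) 1) := by simpa using hF
  exact hF'.comp (1 : G) h1

/-- Chain rule along an arbitrary curve through the identity with velocity `v`. -/
theorem hasDerivAt_comp_curve_mul {F : G → V} {z : G}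
    (hF : MDifferentiableAt (𝓡 d) 𝓘(ℝ, V) F z) {c : ℝ → G} (h0 : c 0 = 1)
    {v : EuclideanSpace ℝ (Fin d)}
    (hc : HasMFDerivAt 𝓘(ℝ, ℝ) (𝓡 d) c 0 (ContinuousLinearMap.smulRight (1 : ℝ →L[ℝ] ℝ) v)) :
    HasDerivAt (fun t => F (c t * z)) (rightInvDeriv (d := d) v F z) 0 := by
  have key : ∀ p : G, p = 1 → HasMFDerivAt (𝓡 d) 𝓘(ℝ, V) (fun h : G => F (h * z)) p
      (mfderiv (𝓡 d) 𝓘(ℝ, V) (fun h : G => F (h * z)) 1) := by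
    rintro _ rfl
    exact (mdifferentiableAt_comp_mul_right hF).hasMFDerivAt
  have h1 : ∀ L : EuclideanSpace ℝ (Fin d) →L[ℝ] V, HasFDerivAt (fun t => F (c t * z))
      (L ∘L ContinuousLinearMap.smulRight (1 : ℝ →L[ℝ] ℝ) v) 0 →
      HasDerivAt (fun t => F (c t * z)) (L v) 0 := fun L hL => by
    simpa using hL.hasDerivAt
  exact h1 _ (hasMFDerivAt_iff_hasFDerivAt.1 ((key (c 0) h0).comp (0 : ℝ) hc))

/-- For a fixed source point and a target that is a vector space, tangent coordinates are trivial. -/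
theorem inTangentCoordinates_const_vectorSpace (p : G) (g : G → V)
    (L : G → EuclideanSpace ℝ (Fin d) →L[ℝ] V) (z x : G) :
    inTangentCoordinates (𝓡 d) 𝓘(ℝ, V) (fun _ : G => p) g L z x = L x := by
  rw [inTangentCoordinates_eq (fun _ : G => p) g L (mem_chart_source _ p)
    (Set.mem_univ _)]
  ext u
  have h1 : ∀ u, (tangentBundleCore (𝓡 d) G).coordChange (achart (EuclideanSpace ℝ (Fin d)) p)
      (achart (EuclideanSpace ℝ (Fin d)) p) p u = u := fun u =>
    (tangentBundleCore (𝓡 d) G).coordChange_self _ _ (mem_chart_source _ p) u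
  change (tangentBundleCore 𝓘(ℝ, V) V).coordChange (achart V (g x)) (achart V (g z)) (g x)
    (L x ((tangentBundleCore (𝓡 d) G).coordChange (achart (EuclideanSpace ℝ (Fin d)) p)
      (achart (EuclideanSpace ℝ (Fin d)) p) p u)) = _
  rw [h1, tangentBundleCore_coordChange_model_space]
  rfl

theorem contMDiffAt_rightInvDeriv (v : LieAlg d G) {F : G → V} {z : G}
    (hF : ContMDiffAt (𝓡 d) 𝓘(ℝ, V) ∞ F z) :
    ContMDiffAt (𝓡 d) 𝓘(ℝ, V) ∞ (rightInvDeriv v F) z := by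
  have hF2 : ContMDiffAt ((𝓡 d).prod (𝓡 d)) 𝓘(ℝ, V) ∞
      (Function.uncurry fun (x h : G) => F (h * x)) (z, (1 : G)) := by
    have h1 : ContMDiffAt ((𝓡 d).prod (𝓡 d)) (𝓡 d) ∞ (fun p : G × G => p.2 * p.1) (z, (1 : G)) :=
      contMDiffAt_snd.mul contMDiffAt_fst
    have hF' : ContMDiffAt (𝓡 d) 𝓘(ℝ, V) ∞ F ((fun p : G × G => p.2 * p.1) (z, (1 : G))) := by
      simpa using hF
    exact hF'.comp (z, (1 : G)) h1
  have h3 := ContMDiffAt.mfderiv_apply (J := 𝓡 d) (J' := 𝓡 d) (I := 𝓡 d) (I' := 𝓘(ℝ, V))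
    (m := ∞) (n := ∞) (x₀ := z) (fun (x h : G) => F (h * x)) (fun _ : G => (1 : G))
    (fun x : G => x) (fun _ => (v : EuclideanSpace ℝ (Fin d))) hF2 contMDiffAt_const contMDiffAt_id
    contMDiffAt_const (by norm_num)
  refine h3.congr_of_eventuallyEq (Eventually.of_forall fun x => ?_)
  exact (congrArg (fun L : EuclideanSpace ℝ (Fin d) →L[ℝ] V => L v)
    (inTangentCoordinates_const_vectorSpace (1 : G) (fun x => F (1 * x))
      (fun x => mfderiv (𝓡 d) 𝓘(ℝ, V) (fun h => F (h * x)) 1) z x)).symm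

variable [T2Space G]

theorem hasMFDerivAt_expCurve_zero (v : LieAlg d G) :
    HasMFDerivAt 𝓘(ℝ, ℝ) (𝓡 d) (expCurve v) 0
      (ContinuousLinearMap.smulRight (1 : ℝ →L[ℝ] ℝ) (v : EuclideanSpace ℝ (Fin d))) := by
  obtain ⟨h0, h⟩ := expCurve_spec v
  have key : ∀ g : G, g = 1 → (mulInvariantVectorField v g : EuclideanSpace ℝ (Fin d)) = v := by
    rintro _ rfl
    change mfderiv (𝓡 d) (𝓡 d) (fun h : G => 1 * h) 1 v = v
    have : ∀ f : G → G, f = id →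
        (mfderiv (𝓡 d) (𝓡 d) f 1 v : EuclideanSpace ℝ (Fin d)) = v := by
      rintro _ rfl
      rw [mfderiv_id]
      rfl
    exact this _ (by ext; simp)
  have h1 := h 0
  refine h1.congr_mfderiv ?_
  exact congrArg (fun u : EuclideanSpace ℝ (Fin d) =>
    ContinuousLinearMap.smulRight (1 : ℝ →L[ℝ] ℝ) u) (key _ h0)

theorem hasDerivAt_comp_expCurve_mul (v : LieAlg d G) {F : G → V} {z : G}
    (hF : MDifferentiableAt (𝓡 d) 𝓘(ℝ, V) F z) :
    HasDerivAt (fun t => F (expCurve v t * z)) (rightInvDeriv v F z) 0 :=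
  hasDerivAt_comp_curve_mul hF (expCurve_spec v).1 (hasMFDerivAt_expCurve_zero v)

theorem continuousAt_expCurve_mul (v : LieAlg d G) (z : G) :
    ContinuousAt (fun t => expCurve v t * z) 0 :=
  ((contMDiff_mul_right_lie (d := d) z (n := 1) (by norm_num)).continuous.continuousAt).comp
    (hasMFDerivAt_expCurve_zero v).continuousAt

theorem hasMFDerivAt_conj_expCurve (v : LieAlg d G) (g : G) :
    HasMFDerivAt 𝓘(ℝ, ℝ) (𝓡 d) (fun t => g * expCurve v t * g⁻¹) 0
      (ContinuousLinearMap.smulRight (1 : ℝ →L[ℝ] ℝ)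
        (lieAd d g v : EuclideanSpace ℝ (Fin d))) := by
  have hconj : MDifferentiableAt (𝓡 d) (𝓡 d) (fun h : G => g * h * g⁻¹) 1 := by
    have : ContMDiff (𝓡 d) (𝓡 d) ∞ (fun h : G => g * h * g⁻¹) :=
      (contMDiff_mul_right (I := 𝓡 d) (a := g⁻¹)).comp (contMDiff_mul_left (I := 𝓡 d) (a := g))
    exact this.mdifferentiable (by simp) 1
  have key : ∀ p : G, p = 1 → HasMFDerivAt (𝓡 d) (𝓡 d) (fun h : G => g * h * g⁻¹) p
      (mfderiv (𝓡 d) (𝓡 d) (fun h : G => g * h * g⁻¹) 1) := by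
    rintro _ rfl
    exact hconj.hasMFDerivAt
  have h1 := (key _ (expCurve_spec v).1).comp (0 : ℝ) (hasMFDerivAt_expCurve_zero v)
  refine h1.congr_mfderiv ?_
  ext
  change (mfderiv (𝓡 d) (𝓡 d) (fun h : G => g * h * g⁻¹) 1) ((1 : ℝ) • v) = (1 : ℝ) • lieAd d g v
  rw [one_smul, one_smul]
  rfl

end RightInvariantDeriv

section LieDeriv

variable {d : ℕ} {G : Type*} [TopologicalSpace G]
  [ChartedSpace (EuclideanSpace ℝ (Fin d)) G] [Group G] {Γ : Subgroup G}

variable (d) in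
/-- A function on `G ⧸ Γ` is smooth if its lift to `G` is. This avoids a manifold structure on the
quotient. -/
def SmoothQuot (f : G ⧸ Γ → ℝ) : Prop :=
  ContMDiff (𝓡 d) 𝓘(ℝ, ℝ) ∞ (fun g : G => f (g : G ⧸ Γ))

variable {f g : G ⧸ Γ → ℝ}

theorem SmoothQuot.mul (hf : SmoothQuot d f) (hg : SmoothQuot d g) :
    SmoothQuot d (fun x => f x * g x) := ContMDiff.mul hf hg

theorem SmoothQuot.one_sub (hf : SmoothQuot d f) : SmoothQuot d (fun x => 1 - f x) :=
  ContMDiff.sub contMDiff_const hf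

theorem SmoothQuot.prod {ι : Type*} (s : Finset ι) {f : ι → G ⧸ Γ → ℝ}
    (hf : ∀ j ∈ s, SmoothQuot d (f j)) : SmoothQuot d (fun x => ∏ j ∈ s, f j x) := by
  classical
  induction s using Finset.induction_on with
  | empty => simpa [SmoothQuot] using contMDiff_const
  | insert j s hj ih =>
    simp only [Finset.prod_insert hj]
    exact (hf j (by simp)).mul (ih fun i hi => hf i (by simp [hi]))

variable [LieGroup (𝓡 d) ∞ G]

theorem SmoothQuot.smul_left (hf : SmoothQuot d f) (a : G) : SmoothQuot d (fun x => f (a • x)) :=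
  ContMDiff.comp (g := fun g : G => f (g : G ⧸ Γ)) hf (contMDiff_mul_left (I := 𝓡 d) (a := a))

theorem SmoothQuot.continuous (hf : SmoothQuot d f) : Continuous f := by
  have : IsTopologicalGroup G := topologicalGroup_of_lieGroup (𝓡 d) ∞
  exact QuotientGroup.isOpenQuotientMap_mk.isQuotientMap.continuous_iff.2 (ContMDiff.continuous hf)

variable [T2Space G]

theorem SmoothQuot.hasDerivAt (hf : SmoothQuot d f) (v : LieAlg d G) (z : G) :
    HasDerivAt (fun t => f (expCurve v t • (z : G ⧸ Γ)))
      (rightInvDeriv v (fun g : G => f (g : G ⧸ Γ)) z) 0 :=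
  hasDerivAt_comp_expCurve_mul v (hf.mdifferentiable (by simp) z)

theorem SmoothQuot.lieDeriv_mk (hf : SmoothQuot d f) (v : LieAlg d G) (z : G) :
    lieDeriv v f (z : G ⧸ Γ) = rightInvDeriv v (fun g : G => f (g : G ⧸ Γ)) z :=
  (hf.hasDerivAt v z).deriv

theorem SmoothQuot.hasDerivAt_lieDeriv (hf : SmoothQuot d f) (v : LieAlg d G) (x : G ⧸ Γ) :
    HasDerivAt (fun t => f (expCurve v t • x)) (lieDeriv v f x) 0 := by
  obtain ⟨z, rfl⟩ := QuotientGroup.mk_surjective x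
  rw [hf.lieDeriv_mk]
  exact hf.hasDerivAt v z

theorem SmoothQuot.lieDeriv (hf : SmoothQuot d f) (v : LieAlg d G) :
    SmoothQuot d (lieDeriv v f) := by
  intro z
  refine (contMDiffAt_rightInvDeriv v (hf z)).congr_of_eventuallyEq ?_
  exact Eventually.of_forall fun z => hf.lieDeriv_mk v z

theorem lieDeriv_add (hf : SmoothQuot d f) (hg : SmoothQuot d g) (v : LieAlg d G) :
    lieDeriv v (fun x => f x + g x) = fun x => lieDeriv v f x + lieDeriv v g x := by
  ext x
  exact ((hf.hasDerivAt_lieDeriv v x).add (hg.hasDerivAt_lieDeriv v x)).deriv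

theorem lieDeriv_mul (hf : SmoothQuot d f) (hg : SmoothQuot d g) (v : LieAlg d G) :
    lieDeriv v (fun x => f x * g x) = fun x => lieDeriv v f x * g x + f x * lieDeriv v g x := by
  ext x
  have h := ((hf.hasDerivAt_lieDeriv v x).fun_mul (hg.hasDerivAt_lieDeriv v x)).deriv
  simp only [(expCurve_spec v).1, one_smul] at h
  exact h

theorem lieDeriv_one_sub (v : LieAlg d G) :
    lieDeriv v (fun x => 1 - f x) = fun x => - lieDeriv v f x := by
  ext x
  simp only [lieDeriv, deriv_const_sub]

/-- Translation by an element acting on `v` through the adjoint action with eigenvalue `s`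
multiplies the derivative along `v` by `s`. -/
theorem lieDeriv_smul_left (hf : SmoothQuot d f) {v : LieAlg d G} {a : G} {s : ℝ}
    (ha : lieAd d a v = s • v) :
    lieDeriv v (fun x => f (a • x)) = fun x => s * lieDeriv v f (a • x) := by
  ext x
  obtain ⟨z, rfl⟩ := QuotientGroup.mk_surjective x
  have h1 := hasDerivAt_comp_curve_mul (c := fun t => a * expCurve v t * a⁻¹)
    (hf.mdifferentiable (by simp) (a * z)) (by simp [(expCurve_spec v).1])
    (hasMFDerivAt_conj_expCurve v a)
  have e : lieDeriv v f (a • (z : G ⧸ Γ)) =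
      rightInvDeriv v (fun g : G => f (g : G ⧸ Γ)) (a * z) := hf.lieDeriv_mk v (a * z)
  have h2 : rightInvDeriv (d := d) (lieAd d a v) (fun g : G => f (g : G ⧸ Γ)) (a * z) =
      s * rightInvDeriv v (fun g : G => f (g : G ⧸ Γ)) (a * z) := by
    rw [ha]; exact rightInvDeriv_smul s v _ _
  rw [e, ← h2, ← h1.deriv, lieDeriv]
  congr 1
  ext t
  congr 1
  change ((a * (expCurve v t * z) : G) : G ⧸ Γ) = ((a * expCurve v t * a⁻¹ * (a * z) : G) : G ⧸ Γ)
  congr 1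
  group

end LieDeriv

/-! ### Bounds on iterated derivatives and Sobolev norms -/

section HasDerivBound

variable {d : ℕ} {G : Type*} [TopologicalSpace G] [T2Space G]
  [ChartedSpace (EuclideanSpace ℝ (Fin d)) G] [Group G] [LieGroup (𝓡 d) ∞ G] {Γ : Subgroup G}

/-- `|D_{ζ (n 0)} ⋯ D_{ζ (n (l - 1))} f| ≤ A * B ^ l` for all `l ≤ k`. The recursion peels off the
derivative that is applied first, which suits the product and chain rules; see
`HasDerivBound.abs_iterLieDeriv_le` for the bound on `iterLieDeriv`. The existence of the
derivatives is not part of the definition. -/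
def HasDerivBound (ζ : Fin d → LieAlg d G) : ℕ → ℝ → ℝ → (G ⧸ Γ → ℝ) → Prop
  | 0, A, _, f => ∀ x, |f x| ≤ A
  | k + 1, A, B, f => (∀ x, |f x| ≤ A) ∧ ∀ i, HasDerivBound ζ k (A * B) B (lieDeriv (ζ i) f)

variable {ζ : Fin d → LieAlg d G} {k : ℕ} {A A' B B' : ℝ} {f g : G ⧸ Γ → ℝ}

namespace HasDerivBound

theorem abs_le (hf : HasDerivBound ζ k A B f) (x : G ⧸ Γ) : |f x| ≤ A := by
  cases k with
  | zero => exact hf x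
  | succ k => exact hf.1 x

theorem nonneg (hf : HasDerivBound ζ k A B f) : 0 ≤ A :=
  (abs_nonneg _).trans (hf.abs_le ((1 : G) : G ⧸ Γ))

theorem mono (hB : 0 ≤ B) (hA' : A ≤ A') (hB' : B ≤ B') (hf : HasDerivBound ζ k A B f) :
    HasDerivBound ζ k A' B' f := by
  induction k generalizing A A' f with
  | zero => exact fun x => (hf x).trans hA'
  | succ k ih =>
    exact ⟨fun x => (hf.1 x).trans hA', fun i =>
      ih (mul_le_mul hA' hB' hB (hf.nonneg.trans hA')) (hf.2 i)⟩

theorem of_succ (hf : HasDerivBound ζ (k + 1) A B f) : HasDerivBound ζ k A B f := by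
  induction k generalizing A f with
  | zero => exact hf.1
  | succ k ih => exact ⟨hf.1, fun i => ih (hf.2 i)⟩

theorem of_le {l : ℕ} (hl : l ≤ k) (hf : HasDerivBound ζ k A B f) : HasDerivBound ζ l A B f := by
  induction hl with
  | refl => exact hf
  | step _ ih => exact ih hf.of_succ

theorem add (hfs : SmoothQuot d f) (hgs : SmoothQuot d g) (hf : HasDerivBound ζ k A B f)
    (hg : HasDerivBound ζ k A' B g) : HasDerivBound ζ k (A + A') B (fun x => f x + g x) := by
  induction k generalizing A A' f g with
  | zero => exact fun x => (abs_add_le _ _).trans (add_le_add (hf x) (hg x))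
  | succ k ih =>
    refine ⟨fun x => (abs_add_le _ _).trans (add_le_add (hf.1 x) (hg.1 x)), fun i => ?_⟩
    rw [lieDeriv_add hfs hgs, add_mul]
    exact ih (hfs.lieDeriv _) (hgs.lieDeriv _) (hf.2 i) (hg.2 i)

theorem const_mul (s : ℝ) (hf : HasDerivBound ζ k A B f) :
    HasDerivBound ζ k (|s| * A) B (fun x => s * f x) := by
  have h0 : ∀ A (f : G ⧸ Γ → ℝ), (∀ x, |f x| ≤ A) → ∀ x, |s * f x| ≤ |s| * A := fun A f h x => by
    rw [abs_mul]; exact mul_le_mul_of_nonneg_left (h x) (abs_nonneg s)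
  induction k generalizing A f with
  | zero => exact h0 _ _ hf
  | succ k ih =>
    refine ⟨h0 _ _ hf.1, fun i => ?_⟩
    have : lieDeriv (ζ i) (fun x => s * f x) = fun x => s * lieDeriv (ζ i) f x := by
      ext x; simp only [lieDeriv, deriv_const_mul_field]
    rw [this, mul_assoc]
    exact ih (hf.2 i)

theorem const {c : ℝ} (hc : |c| ≤ A) (hB : 0 ≤ B) :
    HasDerivBound ζ k A B (fun _ : G ⧸ Γ => c) := by
  induction k generalizing A c with
  | zero => exact fun _ => hc
  | succ k ih =>
    refine ⟨fun _ => hc, fun i => ?_⟩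
    have : lieDeriv (ζ i) (fun _ : G ⧸ Γ => c) = fun _ => 0 := by
      ext x; simp only [lieDeriv, deriv_const]
    rw [this]
    exact ih (by simpa using mul_nonneg ((abs_nonneg c).trans hc) hB)

theorem one_sub (hf : HasDerivBound ζ k 1 B f) (h0 : ∀ x, 0 ≤ f x) :
    HasDerivBound ζ k 1 B (fun x => 1 - f x) := by
  have h : ∀ x, |1 - f x| ≤ 1 := fun x => by
    have := (le_abs_self _).trans (hf.abs_le x)
    rw [_root_.abs_le]; constructor <;> linarith [h0 x]
  cases k with
  | zero => exact h
  | succ k =>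
    refine ⟨h, fun i => ?_⟩
    have e : lieDeriv (ζ i) (fun x => 1 - f x) = fun x => (-1) * lieDeriv (ζ i) f x := by
      rw [lieDeriv_one_sub]; ext x; ring
    rw [e]
    simpa using (hf.2 i).const_mul (-1)

/-- By the product rule, amplitudes multiply and rates add. -/
theorem mul (hfs : SmoothQuot d f) (hgs : SmoothQuot d g)
    (hf : HasDerivBound ζ k A B f) (hg : HasDerivBound ζ k A' B' g) :
    HasDerivBound ζ k (A * A') (B + B') (fun x => f x * g x) := by
  induction k generalizing A A' f g with
  | zero =>
    intro x
    rw [abs_mul]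
    exact mul_le_mul (hf x) (hg x) (abs_nonneg _) hf.nonneg
  | succ k ih =>
    refine ⟨fun x => ?_, fun i => ?_⟩
    · rw [abs_mul]
      exact mul_le_mul (hf.1 x) (hg.1 x) (abs_nonneg _) hf.nonneg
    · rw [lieDeriv_mul hfs hgs, show A * A' * (B + B') = A * B * A' + A * (A' * B') by ring]
      exact add ((hfs.lieDeriv _).mul hgs) (hfs.mul (hgs.lieDeriv _))
        (ih (hfs.lieDeriv _) hgs (hf.2 i) hg.of_succ) (ih hfs (hgs.lieDeriv _) hf.of_succ (hg.2 i))

/-- Translation by an element that acts diagonally on the `ζ i` through the adjoint action scales the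
rate by a bound for the eigenvalues. -/
theorem comp_smul (hfs : SmoothQuot d f) {a : G} {s : Fin d → ℝ} {S : ℝ}
    (ha : ∀ i, lieAd d a (ζ i) = s i • ζ i) (hs : ∀ i, |s i| ≤ S) (hS : 0 ≤ S) (hB : 0 ≤ B)
    (hf : HasDerivBound ζ k A B f) :
    HasDerivBound ζ k A (S * B) (fun x => f (a • x)) := by
  induction k generalizing A f with
  | zero => exact fun x => hf _
  | succ k ih =>
    refine ⟨fun x => hf.1 _, fun i => ?_⟩
    rw [lieDeriv_smul_left hfs (ha i)]
    refine ((ih (hfs.lieDeriv _) (hf.2 i)).const_mul (s i)).mono (mul_nonneg hS hB) ?_ le_rfl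
    rw [show A * (S * B) = S * (A * B) by ring]
    exact mul_le_mul_of_nonneg_right (hs i) (mul_nonneg hf.nonneg hB)

/-- For `|f| ≤ 1` the constant in front can be absorbed in the growth rate. -/
theorem of_abs_le_one (hf : HasDerivBound ζ k A B f) (hA : 1 ≤ A) (hB : 0 ≤ B)
    (h1 : ∀ x, |f x| ≤ 1) : HasDerivBound ζ k 1 (A * B) f := by
  cases k with
  | zero => exact h1
  | succ k =>
    exact ⟨h1, fun i => (hf.2 i).mono hB (one_mul (A * B)).ge (le_mul_of_one_le_left hB hA)⟩

end HasDerivBound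

theorem HasDerivBound.prod {ι : Type*} (s : Finset ι) {f : ι → G ⧸ Γ → ℝ} {b : ι → ℝ}
    (hfs : ∀ j ∈ s, SmoothQuot d (f j)) (hf : ∀ j ∈ s, HasDerivBound ζ k 1 (b j) (f j)) :
    HasDerivBound ζ k 1 (∑ j ∈ s, b j) (fun x => ∏ j ∈ s, f j x) := by
  classical
  induction s using Finset.induction_on with
  | empty => simpa using HasDerivBound.const (by simp) le_rfl
  | insert j s hj ih =>
    simp only [Finset.prod_insert hj, Finset.sum_insert hj]
    simpa using HasDerivBound.mul (hfs j (by simp))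
      (SmoothQuot.prod s fun i hi => hfs i (by simp [hi])) (hf j (by simp))
      (ih (fun i hi => hfs i (by simp [hi])) (fun i hi => hf i (by simp [hi])))

theorem iterLieDeriv_succ_last (l : ℕ) (n : Fin (l + 1) → Fin d) (f : G ⧸ Γ → ℝ) :
    iterLieDeriv ζ (l + 1) n f =
      iterLieDeriv ζ l (Fin.init n) (lieDeriv (ζ (n (Fin.last l))) f) := by
  induction l with
  | zero => rfl
  | succ l ih =>
    change lieDeriv (ζ (n 0)) (iterLieDeriv ζ (l + 1) (Fin.tail n) f) = _
    rw [ih, ← Fin.tail_init_eq_init_tail]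
    rfl

theorem SmoothQuot.iterLieDeriv (hf : SmoothQuot d f) (l : ℕ) (n : Fin l → Fin d) :
    SmoothQuot d (iterLieDeriv ζ l n f) := by
  induction l with
  | zero => exact hf
  | succ l ih => exact (ih _).lieDeriv _

theorem HasDerivBound.abs_iterLieDeriv_le {l : ℕ} (hf : HasDerivBound ζ l A B f)
    (n : Fin l → Fin d) (x : G ⧸ Γ) : |iterLieDeriv ζ l n f x| ≤ A * B ^ l := by
  induction l generalizing A f with
  | zero => simpa [iterLieDeriv] using hf x
  | succ l ih =>
    rw [iterLieDeriv_succ_last, pow_succ', ← mul_assoc]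
    exact ih (hf.2 _) _

variable [MeasurableSpace (G ⧸ Γ)] {μ : Measure (G ⧸ Γ)}
  [IsProbabilityMeasure μ]

theorem HasDerivBound.sobolevNorm_le (hf : HasDerivBound ζ k A B f) (hB : 0 ≤ B) :
    sobolevNorm ζ μ k f ≤ √(∑ l ∈ Finset.range (k + 1), (d : ℝ) ^ l) * (A * max 1 B ^ k) := by
  have hM : 0 ≤ A * max 1 B ^ k := mul_nonneg hf.nonneg (by positivity)
  rw [sobolevNorm, ← Real.sqrt_sq hM, ← Real.sqrt_mul (by positivity)]
  refine Real.sqrt_le_sqrt ?_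
  rw [Finset.sum_mul]
  refine Finset.sum_le_sum fun l hl => ?_
  have hlk : l ≤ k := Nat.lt_succ_iff.1 (Finset.mem_range.1 hl)
  refine (Finset.sum_le_card_nsmul _ _ ((A * max 1 B ^ k) ^ 2) fun n _ => ?_).trans ?_
  · have h1 : ∀ x, ‖iterLieDeriv ζ l n f x‖ ≤ A * max 1 B ^ k := fun x =>
      ((hf.of_le hlk).abs_iterLieDeriv_le n x).trans <| mul_le_mul_of_nonneg_left
        ((pow_le_pow_left₀ hB (le_max_right 1 B) l).trans
          (pow_le_pow_right₀ (le_max_left 1 B) hlk)) hf.nonneg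
    have h2 := eLpNorm_le_of_ae_bound (μ := μ) (p := 2) (Eventually.of_forall h1)
    simp only [measure_univ, ENNReal.one_rpow, one_mul] at h2
    gcongr
    exact ENNReal.toReal_le_of_le_ofReal hM h2
  · simp

variable [BorelSpace (G ⧸ Γ)]

theorem HasDerivBound.memSobolev (hf : HasDerivBound ζ k A B f) (hfs : SmoothQuot d f) :
    MemSobolev ζ μ k f where
  differentiableAt l _ n i x :=
    ((hfs.iterLieDeriv l n).hasDerivAt_lieDeriv (ζ i) x).differentiableAt
  memLp l hl n := MemLp.of_bound (hfs.iterLieDeriv l n).continuous.aestronglyMeasurable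
    (A * B ^ l) (Eventually.of_forall fun x => (hf.of_le hl).abs_iterLieDeriv_le n x)

end HasDerivBound

/-! ### Functions on `G ⧸ Γ` given in a chart -/

section ChartProfile

variable {d : ℕ} {G : Type*} [TopologicalSpace G] [Group G] {Γ : Subgroup G}

/-- The function `q` on Euclidean space, transported to `G ⧸ Γ` by a chart `Ψ` of `G` and the map
`z ↦ z g₀ Γ`, and extended by zero. It is meaningful if `z ↦ z g₀ Γ` is injective on the domain of
`Ψ`. -/
noncomputable def chartProfile (Γ : Subgroup G) (Ψ : OpenPartialHomeomorph G (EuclideanSpace ℝ (Fin d)))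
    (g₀ : G) (q : EuclideanSpace ℝ (Fin d) → ℝ) : G ⧸ Γ → ℝ :=
  Function.extend (fun z : Ψ.source => (((z : G) * g₀ : G) : G ⧸ Γ)) (fun z => q (Ψ z)) 0

variable {Ψ : OpenPartialHomeomorph G (EuclideanSpace ℝ (Fin d))} {g₀ : G}
  {q : EuclideanSpace ℝ (Fin d) → ℝ} {r : ℝ}

theorem chartProfile_mk (hinj : Set.InjOn (fun z => ((z * g₀ : G) : G ⧸ Γ)) Ψ.source) {z : G}
    (hz : z ∈ Ψ.source) : chartProfile Γ Ψ g₀ q ((z * g₀ : G) : G ⧸ Γ) = q (Ψ z) :=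
  (Set.injOn_iff_injective.1 hinj).extend_apply (fun z : Ψ.source => q (Ψ z)) 0 ⟨z, hz⟩

theorem chartProfile_eq_zero {x : G ⧸ Γ} (hx : ∀ z ∈ Ψ.source, ((z * g₀ : G) : G ⧸ Γ) ≠ x) :
    chartProfile Γ Ψ g₀ q x = 0 :=
  Function.extend_apply' _ _ _ fun ⟨z, hz⟩ => hx z z.2 hz

theorem chartProfile_const_mul (s : ℝ) (x : G ⧸ Γ) :
    chartProfile Γ Ψ g₀ (fun u => s * q u) x = s * chartProfile Γ Ψ g₀ q x := by
  classical
  simp only [chartProfile, Function.extend_def]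
  split_ifs <;> simp

theorem abs_chartProfile_le {A : ℝ} (hA : 0 ≤ A) (hq : ∀ u, |q u| ≤ A) (x : G ⧸ Γ) :
    |chartProfile Γ Ψ g₀ q x| ≤ A := by
  classical
  simp only [chartProfile, Function.extend_def]
  split_ifs
  · exact hq _
  · simpa using hA

variable [ChartedSpace (EuclideanSpace ℝ (Fin d)) G] [LieGroup (𝓡 d) ∞ G]

/-- In the chart, a right-invariant vector field agrees near the origin with a smooth vector field
on Euclidean space. -/
theorem exists_vectorField_eq_rightInvDeriv
    (hΨ : ContMDiffOn (𝓡 d) 𝓘(ℝ, EuclideanSpace ℝ (Fin d)) ∞ Ψ Ψ.source)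
    (hΨ' : ContMDiffOn 𝓘(ℝ, EuclideanSpace ℝ (Fin d)) (𝓡 d) ∞ Ψ.symm Ψ.target) (v : LieAlg d G)
    (hr0 : 0 < r) (hr : Metric.closedBall 0 (2 * r) ⊆ Ψ.target) :
    ∃ X : EuclideanSpace ℝ (Fin d) → EuclideanSpace ℝ (Fin d), ContDiff ℝ ∞ X ∧
      ∀ z ∈ Ψ.source, ‖Ψ z‖ ≤ r → rightInvDeriv v Ψ z = X (Ψ z) := by
  let θ : ContDiffBump (0 : EuclideanSpace ℝ (Fin d)) := ⟨r, 2 * r, hr0, by linarith⟩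
  refine ⟨fun u => θ u • rightInvDeriv v Ψ (Ψ.symm u), ?_, fun z hz hzr => ?_⟩
  · rw [contDiff_iff_contDiffAt]
    intro u
    by_cases hu : u ∈ Metric.closedBall 0 (2 * r)
    · refine θ.contDiffAt.smul ?_
      rw [← contMDiffAt_iff_contDiffAt]
      refine ContMDiffAt.comp (g := rightInvDeriv v Ψ) u (contMDiffAt_rightInvDeriv v ?_)
        (hΨ'.contMDiffAt (Ψ.open_target.mem_nhds (hr hu)))
      exact hΨ.contMDiffAt (Ψ.open_source.mem_nhds (Ψ.map_target (hr hu)))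
    · refine (contDiffAt_const (c := (0 : EuclideanSpace ℝ (Fin d)))).congr_of_eventuallyEq ?_
      filter_upwards [Metric.isClosed_closedBall.isOpen_compl.mem_nhds hu] with y hy
      have : θ y = 0 := θ.zero_of_le_dist (le_of_lt (by simpa using hy))
      rw [this, zero_smul]
  · change _ = θ (Ψ z) • rightInvDeriv v Ψ (Ψ.symm (Ψ z))
    rw [θ.one_of_mem_closedBall (by simpa using hzr), one_smul, Ψ.left_inv hz]

variable [T2Space G] [DiscreteTopology Γ]

/-- Off the compact set where `q` lives, the transported function vanishes locally. -/
theorem eventually_chartProfile_eq_zero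
    (hinj : Set.InjOn (fun z => ((z * g₀ : G) : G ⧸ Γ)) Ψ.source)
    (hr : Metric.closedBall 0 r ⊆ Ψ.target) (hq : ∀ u, r < ‖u‖ → q u = 0) {x : G ⧸ Γ}
    (hx : ∀ z ∈ Ψ.source, ((z * g₀ : G) : G ⧸ Γ) = x → r < ‖Ψ z‖) :
    ∀ᶠ y in 𝓝 x, chartProfile Γ Ψ g₀ q y = 0 := by
  have htop : IsTopologicalGroup G := topologicalGroup_of_lieGroup (𝓡 d) ∞
  have hΓ : IsClosed (Γ : Set G) := Subgroup.isClosed_of_discrete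
  have hK : IsClosed ((fun u => ((Ψ.symm u * g₀ : G) : G ⧸ Γ)) '' Metric.closedBall 0 r) := by
    refine (IsCompact.image_of_continuousOn (isCompact_closedBall _ _) ?_).isClosed
    exact (QuotientGroup.continuous_mk.comp (continuous_mul_const g₀)).comp_continuousOn
      (Ψ.continuousOn_symm.mono hr)
  have hxK : x ∉ (fun u => ((Ψ.symm u * g₀ : G) : G ⧸ Γ)) '' Metric.closedBall 0 r := by
    rintro ⟨u, hu, rfl⟩
    have := hx _ (Ψ.map_target (hr hu)) rfl
    rw [Ψ.right_inv (hr hu)] at this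
    exact this.not_ge (by simpa using hu)
  filter_upwards [hK.isOpen_compl.mem_nhds hxK] with y hy
  by_cases h : ∃ z ∈ Ψ.source, ((z * g₀ : G) : G ⧸ Γ) = y
  · obtain ⟨z, hz, rfl⟩ := h
    rw [chartProfile_mk hinj hz]
    refine hq _ (lt_of_not_ge fun h => hy ⟨Ψ z, by simpa using h, ?_⟩)
    simp only [Ψ.left_inv hz]
  · exact chartProfile_eq_zero fun z hz hzy => h ⟨z, hz, hzy⟩

theorem smoothQuot_chartProfile
    (hΨ : ContMDiffOn (𝓡 d) 𝓘(ℝ, EuclideanSpace ℝ (Fin d)) ∞ Ψ Ψ.source)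
    (hinj : Set.InjOn (fun z => ((z * g₀ : G) : G ⧸ Γ)) Ψ.source)
    (hr : Metric.closedBall 0 r ⊆ Ψ.target) (hqs : ContDiff ℝ ∞ q) (hq : ∀ u, r < ‖u‖ → q u = 0) :
    SmoothQuot d (chartProfile Γ Ψ g₀ q) := by
  have htop : IsTopologicalGroup G := topologicalGroup_of_lieGroup (𝓡 d) ∞
  intro g
  by_cases h : ∃ z ∈ Ψ.source, ((z * g₀ : G) : G ⧸ Γ) = g
  · obtain ⟨z, hz, hzg⟩ := h
    set t : G := g⁻¹ * (z * g₀) with ht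
    have htΓ : t ∈ Γ := QuotientGroup.eq.1 hzg.symm
    have hg : g * (t * g₀⁻¹) = z := by rw [ht]; group
    have h1 : ContMDiffAt (𝓡 d) 𝓘(ℝ, ℝ) ∞ (fun y : G => q (Ψ (y * (t * g₀⁻¹)))) g := by
      have h2 : ContMDiffAt (𝓡 d) 𝓘(ℝ, EuclideanSpace ℝ (Fin d)) ∞ Ψ (g * (t * g₀⁻¹)) := by
        rw [hg]; exact hΨ.contMDiffAt (Ψ.open_source.mem_nhds hz)
      exact hqs.contMDiff.contMDiffAt.comp g
        (h2.comp g (contMDiff_mul_right_lie (d := d) (t * g₀⁻¹) (n := ∞) le_rfl).contMDiffAt)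
    refine h1.congr_of_eventuallyEq ?_
    have h3 : ∀ᶠ y in 𝓝 g, y * (t * g₀⁻¹) ∈ Ψ.source :=
      (continuous_mul_const (t * g₀⁻¹)).continuousAt.eventually_mem
        (Ψ.open_source.mem_nhds (by rwa [hg]))
    filter_upwards [h3] with y hy
    rw [← chartProfile_mk (q := q) hinj hy]
    congr 1
    exact QuotientGroup.eq.2 (by simpa [mul_assoc] using htΓ)
  · have h1 := eventually_chartProfile_eq_zero (Γ := Γ) hinj hr hq (x := (g : G ⧸ Γ))
      fun z hz hzg => (h ⟨z, hz, hzg⟩).elim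
    have h2 := QuotientGroup.continuous_mk.continuousAt.eventually h1
    exact (contMDiffAt_const (c := (0 : ℝ))).congr_of_eventuallyEq h2

/-- In the chart, `D_v` is the derivative along the vector field `X` that represents the
right-invariant vector field of `v`. -/
theorem lieDeriv_chartProfile
    (hΨ : ContMDiffOn (𝓡 d) 𝓘(ℝ, EuclideanSpace ℝ (Fin d)) ∞ Ψ Ψ.source)
    (hinj : Set.InjOn (fun z => ((z * g₀ : G) : G ⧸ Γ)) Ψ.source)
    (hr : Metric.closedBall 0 r ⊆ Ψ.target) (hqs : ContDiff ℝ ∞ q) (hq : ∀ u, r < ‖u‖ → q u = 0)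
    {v : LieAlg d G} {X : EuclideanSpace ℝ (Fin d) → EuclideanSpace ℝ (Fin d)}
    (hX : ∀ z ∈ Ψ.source, ‖Ψ z‖ ≤ r → rightInvDeriv v Ψ z = X (Ψ z)) :
    lieDeriv v (chartProfile Γ Ψ g₀ q) =
      chartProfile Γ Ψ g₀ (fun u => fderiv ℝ q u (X u)) := by
  have htop : IsTopologicalGroup G := topologicalGroup_of_lieGroup (𝓡 d) ∞
  ext x
  by_cases h : ∃ z ∈ Ψ.source, ((z * g₀ : G) : G ⧸ Γ) = x
  · obtain ⟨z, hz, rfl⟩ := h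
    rw [chartProfile_mk hinj hz]
    have h1 : HasDerivAt (fun t => Ψ (expCurve v t * z)) (rightInvDeriv v Ψ z) 0 :=
      hasDerivAt_comp_expCurve_mul v
        ((hΨ.contMDiffAt (Ψ.open_source.mem_nhds hz)).mdifferentiableAt (by simp))
    have h0 : Ψ (expCurve v 0 * z) = Ψ z := by rw [(expCurve_spec v).1, one_mul]
    have h2 : HasDerivAt (fun t => q (Ψ (expCurve v t * z)))
        (fderiv ℝ q (Ψ z) (rightInvDeriv v Ψ z)) 0 := by
      have hq1 : HasFDerivAt q (fderiv ℝ q (Ψ z)) (Ψ (expCurve v 0 * z)) := by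
        rw [h0]; exact (hqs.differentiable (by simp) _).hasFDerivAt
      exact hq1.comp_hasDerivAt (0 : ℝ) h1
    have h3 : ∀ᶠ t in 𝓝 (0 : ℝ), expCurve v t * z ∈ Ψ.source :=
      (continuousAt_expCurve_mul v z).eventually_mem
        (Ψ.open_source.mem_nhds (by rwa [(expCurve_spec v).1, one_mul]))
    have h4 : lieDeriv v (chartProfile Γ Ψ g₀ q) ((z * g₀ : G) : G ⧸ Γ) =
        fderiv ℝ q (Ψ z) (rightInvDeriv v Ψ z) := by
      rw [← h2.deriv]
      refine Filter.EventuallyEq.deriv_eq ?_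
      filter_upwards [h3] with t ht
      rw [← chartProfile_mk (q := q) hinj ht, mul_assoc]
      rfl
    rw [h4]
    rcases le_or_gt ‖Ψ z‖ r with hzr | hzr
    · rw [hX z hz hzr]
    · have : q =ᶠ[𝓝 (Ψ z)] fun _ => 0 :=
        (continuous_norm.isOpen_preimage _ isOpen_Ioi).mem_nhds hzr |> fun h =>
          Filter.mem_of_superset h fun u hu => hq u hu
      rw [this.fderiv_eq]
      simp
  · rw [chartProfile_eq_zero fun z hz hzx => h ⟨z, hz, hzx⟩]
    have h1 := eventually_chartProfile_eq_zero (Γ := Γ) hinj hr hq (x := x)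
      fun z hz hzg => (h ⟨z, hz, hzg⟩).elim
    obtain ⟨g, rfl⟩ := QuotientGroup.mk_surjective x
    have hc : Tendsto (fun t => ((expCurve v t * g : G) : G ⧸ Γ)) (𝓝 0) (𝓝 (g : G ⧸ Γ)) := by
      have := (QuotientGroup.continuous_mk (N := Γ)).continuousAt.comp
        (continuousAt_expCurve_mul v g)
      rw [ContinuousAt] at this
      rw [Function.comp_apply, (expCurve_spec v).1, one_mul] at this
      exact this
    have h2 : (fun t => chartProfile Γ Ψ g₀ q (expCurve v t • (g : G ⧸ Γ))) =ᶠ[𝓝 0]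
        fun _ => 0 := hc.eventually h1
    rw [lieDeriv, h2.deriv_eq, deriv_const]

/-- Rescaling a profile by `R` costs a factor `R⁻¹` for each derivative, uniformly in small `R`.
The profile `Q R` may depend smoothly on the scale `R`; this is what makes the induction work, as
the vector fields do not scale exactly. -/
theorem exists_hasDerivBound_chartProfile
    (hΨ : ContMDiffOn (𝓡 d) 𝓘(ℝ, EuclideanSpace ℝ (Fin d)) ∞ Ψ Ψ.source)
    (hinj : Set.InjOn (fun z => ((z * g₀ : G) : G ⧸ Γ)) Ψ.source)
    (hΨ' : ContMDiffOn 𝓘(ℝ, EuclideanSpace ℝ (Fin d)) (𝓡 d) ∞ Ψ.symm Ψ.target)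
    (ζ : Fin d → LieAlg d G) (hr0 : 0 < r) (hr : Metric.closedBall 0 (4 * r) ⊆ Ψ.target) (k : ℕ)
    (Q : ℝ × EuclideanSpace ℝ (Fin d) → ℝ) (hQ : ContDiff ℝ ∞ Q)
    (hQ0 : ∀ R u, 2 < ‖u‖ → Q (R, u) = 0) :
    ∃ C : ℝ, ∀ R, 0 < R → R ≤ r →
      HasDerivBound ζ k C R⁻¹ (chartProfile Γ Ψ g₀ fun u => Q (R, R⁻¹ • u)) := by
  have hbdd : ∀ Q : ℝ × EuclideanSpace ℝ (Fin d) → ℝ, ContDiff ℝ ∞ Q →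
      (∀ R u, 2 < ‖u‖ → Q (R, u) = 0) → ∃ C, 0 ≤ C ∧ ∀ R, 0 < R → R ≤ r →
        ∀ x, |chartProfile Γ Ψ g₀ (fun u => Q (R, R⁻¹ • u)) x| ≤ C := by
    intro Q hQ hQ0
    obtain ⟨C, hC⟩ := ((isCompact_Icc (a := (0 : ℝ)) (b := r)).prod
      (isCompact_closedBall (0 : EuclideanSpace ℝ (Fin d)) 2)).exists_bound_of_continuousOn
        hQ.continuous.continuousOn
    refine ⟨max C 0, le_max_right _ _, fun R hR hRr => abs_chartProfile_le (le_max_right _ _) ?_⟩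
    intro u
    rcases le_or_gt ‖R⁻¹ • u‖ 2 with h | h
    · exact (hC (R, R⁻¹ • u) ⟨⟨hR.le, hRr⟩, by simpa using h⟩).trans (le_max_left _ _)
    · rw [hQ0 R _ h, abs_zero]; exact le_max_right _ _
  choose X hXs hX using fun i => exists_vectorField_eq_rightInvDeriv hΨ hΨ' (ζ i)
    (r := 2 * r) (by positivity) (by convert hr using 2; ring)
  induction k generalizing Q with
  | zero =>
    obtain ⟨C, -, hC⟩ := hbdd Q hQ hQ0
    exact ⟨C, hC⟩
  | succ k ih =>
    have hQd : Differentiable ℝ Q := hQ.differentiable (by simp)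
    let Q' : Fin d → ℝ × EuclideanSpace ℝ (Fin d) → ℝ := fun i p =>
      fderiv ℝ Q p (0, X i (p.1 • p.2))
    have hQ's : ∀ i, ContDiff ℝ ∞ (Q' i) := fun i =>
      (hQ.fderiv_right (m := ∞) (by simp)).clm_apply
        (contDiff_const.prodMk ((hXs i).comp (contDiff_fst.smul contDiff_snd)))
    have hQ'0 : ∀ i R u, 2 < ‖u‖ → Q' i (R, u) = 0 := by
      intro i R u hu
      have : Q =ᶠ[𝓝 (R, u)] fun _ => 0 := by
        have hopen : IsOpen {p : ℝ × EuclideanSpace ℝ (Fin d) | 2 < ‖p.2‖} :=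
          isOpen_lt continuous_const continuous_snd.norm
        filter_upwards [hopen.mem_nhds hu] with p hp
        exact hQ0 p.1 p.2 hp
      simp only [Q', this.fderiv_eq]
      simp
    choose C' hC' using fun i => ih (Q' i) (hQ's i) (hQ'0 i)
    obtain ⟨C, hC0, hC⟩ := hbdd Q hQ hQ0
    refine ⟨C + ∑ i, |C' i|, fun R hR hRr => ⟨fun x => (hC R hR hRr x).trans
      (le_add_of_nonneg_right (Finset.sum_nonneg fun i _ => abs_nonneg _)), fun i => ?_⟩⟩
    have hder : lieDeriv (ζ i) (chartProfile Γ Ψ g₀ fun u => Q (R, R⁻¹ • u)) =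
        fun x => R⁻¹ * chartProfile Γ Ψ g₀ (fun u => Q' i (R, R⁻¹ • u)) x := by
      have hrr : Metric.closedBall (0 : EuclideanSpace ℝ (Fin d)) (2 * r) ⊆ Ψ.target :=
        (Metric.closedBall_subset_closedBall (by linarith)).trans hr
      have hs : ContDiff ℝ ∞ fun u : EuclideanSpace ℝ (Fin d) => Q (R, R⁻¹ • u) :=
        hQ.comp (contDiff_const.prodMk (contDiff_id.const_smul R⁻¹))
      have h0 : ∀ u : EuclideanSpace ℝ (Fin d), 2 * r < ‖u‖ → Q (R, R⁻¹ • u) = 0 := by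
        intro u hu
        refine hQ0 _ _ ?_
        rw [norm_smul, norm_inv, Real.norm_of_nonneg hR.le, ← div_eq_inv_mul, lt_div_iff₀ hR]
        nlinarith
      rw [lieDeriv_chartProfile hΨ hinj hrr hs h0 (hX i)]
      ext x
      rw [← chartProfile_const_mul]
      congr 1
      ext u
      have h1 : HasFDerivAt (fun u : EuclideanSpace ℝ (Fin d) => Q (R, R⁻¹ • u))
          ((fderiv ℝ Q (R, R⁻¹ • u)).comp ((0 : EuclideanSpace ℝ (Fin d) →L[ℝ] ℝ).prod
            (R⁻¹ • ContinuousLinearMap.id ℝ _))) u :=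
        (hQd (R, R⁻¹ • u)).hasFDerivAt.comp u
          ((hasFDerivAt_const R u).prodMk ((hasFDerivAt_id u).const_smul R⁻¹))
      rw [h1.fderiv]
      simp only [Q', smul_smul, mul_inv_cancel₀ hR.ne', one_smul]
      have : (0, R⁻¹ • X i u) = R⁻¹ • ((0 : ℝ), X i u) := by simp
      change fderiv ℝ Q (R, R⁻¹ • u) (0, R⁻¹ • X i u) = _
      rw [this, map_smul, smul_eq_mul]
    rw [hder]
    refine ((hC' i R hR hRr).const_mul R⁻¹).mono (by positivity) ?_ le_rfl
    rw [abs_of_pos (by positivity : (0 : ℝ) < R⁻¹), mul_comm]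
    refine mul_le_mul_of_nonneg_right ?_ (by positivity)
    exact (le_abs_self _).trans ((Finset.single_le_sum (f := fun i => |C' i|)
      (fun i _ => abs_nonneg _) (Finset.mem_univ i)).trans (le_add_of_nonneg_left hC0))

end ChartProfile

/-! ### Bump functions adapted to small balls -/

section Bump

variable {d : ℕ} {G : Type*} [TopologicalSpace G] [ChartedSpace (EuclideanSpace ℝ (Fin d)) G]
  [Group G] [LieGroup (𝓡 d) ∞ G] [RiemannianBundle (fun x : G => TangentSpace (𝓡 d) x)]
  [IsContMDiffRiemannianBundle (𝓡 d) ∞ (EuclideanSpace ℝ (Fin d))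
      (fun x : G => TangentSpace (𝓡 d) x)]

variable (d) in
/-- Inside any neighbourhood of the identity there is a smooth chart, centred at the identity, that
changes distances to the identity by a factor at most `c`. -/
theorem exists_almost_isometric_chart_one [T3Space G] {c : ℝ≥0} (hc : 1 < c) {W : Set G}
    (hW : W ∈ 𝓝 (1 : G)) :
    ∃ Ψ : OpenPartialHomeomorph G (EuclideanSpace ℝ (Fin d)), 1 ∈ Ψ.source ∧ Ψ.source ⊆ W ∧
      Ψ 1 = 0 ∧ ContMDiffOn (𝓡 d) 𝓘(ℝ, EuclideanSpace ℝ (Fin d)) ∞ Ψ Ψ.source ∧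
      ContMDiffOn 𝓘(ℝ, EuclideanSpace ℝ (Fin d)) (𝓡 d) ∞ Ψ.symm Ψ.target ∧
      ∀ z ∈ Ψ.source, ENNReal.ofReal ‖Ψ z‖ ≤ c * riemannianEDist (𝓡 d) z 1 ∧
        riemannianEDist (𝓡 d) z 1 ≤ c * ENNReal.ofReal ‖Ψ z‖ := by
  have := isContinuousRiemannianBundle_of_contMDiff d G
  obtain ⟨A, hA⟩ := exists_chart_almost_isometric (d := d) (1 : G)
  obtain ⟨U, hU, hUd⟩ := hA c hc
  obtain ⟨O, hO, hOo, hO1⟩ := mem_nhds_iff.1 (inter_mem hU hW)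
  let φ : OpenPartialHomeomorph G (EuclideanSpace ℝ (Fin d)) := chartAt _ (1 : G)
  let T : EuclideanSpace ℝ (Fin d) ≃ₜ EuclideanSpace ℝ (Fin d) :=
    A.toHomeomorph.trans (Homeomorph.addRight (-(A (φ 1))))
  have hT : ContDiff ℝ ∞ T := A.contDiff.add contDiff_const
  have hT' : ContDiff ℝ ∞ T.symm :=
    A.symm.contDiff.comp (contDiff_id.add contDiff_const)
  refine ⟨(φ.transHomeomorph T).restrOpen O hOo, ⟨mem_chart_source _ _, hO1⟩,
    fun z hz => (hO hz.2).2, ?_, ?_, ?_, ?_⟩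
  · change A (φ 1) + -(A (φ 1)) = 0
    exact add_neg_cancel _
  · exact hT.contMDiff.comp_contMDiffOn ((contMDiffOn_chart (I := 𝓡 d) (n := ∞)
      (x := (1 : G))).mono fun z hz => hz.1)
  · refine ContMDiffOn.comp (g := φ.symm) (f := T.symm)
      (contMDiffOn_chart_symm (I := 𝓡 d) (n := ∞) (x := (1 : G))) hT'.contMDiff.contMDiffOn ?_
    intro u hu
    exact hu.1
  · intro z hz
    have h := hUd z (hO hz.2).1 1 (hO hO1).1
    have e : edist (A (extChartAt (𝓡 d) (1 : G) z)) (A (extChartAt (𝓡 d) (1 : G) 1)) =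
        ENNReal.ofReal ‖(φ.transHomeomorph T).restrOpen O hOo z‖ := by
      rw [edist_dist, dist_eq_norm, sub_eq_add_neg]
      rfl
    rwa [e] at h

/-- Smooth bump functions adapted to small balls of radius `R`, whose `l`-th derivatives are
`O(R ^ (-l))`. -/
theorem exists_bump_homEDist [T2Space G] (hmetric : IsRightInvariantMetric d G) (Γ : Subgroup G)
    [DiscreteTopology Γ] (ζ : Fin d → LieAlg d G) (k : ℕ) (x₀ : G ⧸ Γ) {b : ℝ} (hb : 1 < b) :
    ∃ C R₀ : ℝ, 0 < C ∧ 0 < R₀ ∧ ∀ R, 0 < R → R < R₀ → ∃ f : G ⧸ Γ → ℝ, SmoothQuot d f ∧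
      (∀ x, 0 ≤ f x) ∧ (∀ x, f x ≤ 1) ∧
      (∀ x, homEDist d x x₀ < ENNReal.ofReal R → f x = 1) ∧
      (∀ x, f x ≠ 0 → homEDist d x x₀ < ENNReal.ofReal (b * R)) ∧
      HasDerivBound ζ k 1 (C / R) f := by
  have htop : IsTopologicalGroup G := topologicalGroup_of_lieGroup (𝓡 d) ∞
  -- three factors `c` are lost: the plateau, the decay of the bump and the chart
  obtain ⟨c, hc1, hc2, hc3⟩ : ∃ c : ℝ, 1 < c ∧ c ^ 2 ≤ 2 ∧ c ^ 3 ≤ b := by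
    have h2 : ∀ᶠ c : ℝ in 𝓝[>] 1, c ^ 2 < 2 :=
      ((continuous_pow 2).tendsto' (1 : ℝ) 1 (by simp)).mono_left nhdsWithin_le_nhds
        |>.eventually_lt_const (by norm_num)
    have h3 : ∀ᶠ c : ℝ in 𝓝[>] 1, c ^ 3 < b :=
      ((continuous_pow 3).tendsto' (1 : ℝ) 1 (by simp)).mono_left nhdsWithin_le_nhds
        |>.eventually_lt_const hb
    obtain ⟨c, h, h', h''⟩ := (h2.and (h3.and self_mem_nhdsWithin)).exists
    exact ⟨c, h'', h.le, h'.le⟩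
  have hc0 : 0 < c := by linarith
  obtain ⟨g₀, rfl⟩ := QuotientGroup.mk_surjective x₀
  obtain ⟨W, hWo, hW1, hWinj⟩ := exists_isOpen_injOn_mk Γ g₀
  obtain ⟨Ψ, h1, hsub, hΨ1, hΨ, hΨ', hdist⟩ := exists_almost_isometric_chart_one d
    (c := c.toNNReal) (Real.one_lt_toNNReal.2 hc1) (hWo.mem_nhds hW1)
  have hinj := hWinj.mono hsub
  obtain ⟨s, hs, hsΨ⟩ : ∃ s > 0, Metric.closedBall 0 s ⊆ Ψ.target :=
    Metric.nhds_basis_closedBall.mem_iff.1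
      (Ψ.open_target.mem_nhds (by rw [← hΨ1]; exact Ψ.map_source h1))
  obtain ⟨t, ht, htΨ⟩ := exists_setOf_riemannianEDist_lt_subset (d := d)
    (Ψ.open_source.mem_nhds h1)
  let θ : ContDiffBump (0 : EuclideanSpace ℝ (Fin d)) := ⟨c, c ^ 2, hc0, by nlinarith⟩
  have hθ0 : ∀ u, θ u ≠ 0 → ‖u‖ < c ^ 2 := fun u hu => by
    have : u ∈ Function.support θ := hu
    rw [θ.support_eq] at this
    simpa using this
  obtain ⟨C, hC⟩ := exists_hasDerivBound_chartProfile (Γ := Γ) hΨ hinj hΨ' ζ (r := s / 4)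
    (by positivity) (by convert hsΨ using 2; ring) k (fun p => θ p.2) (θ.contDiff.comp contDiff_snd)
    (fun R u hu => by by_contra h; linarith [hθ0 u h])
  refine ⟨max C 1, min t (s / 4), by positivity, by positivity, fun R hR hRlt => ?_⟩
  have hRt : R < t := hRlt.trans_le (min_le_left _ _)
  have hRs : R ≤ s / 4 := (hRlt.trans_le (min_le_right _ _)).le
  have hnorm : ∀ u : EuclideanSpace ℝ (Fin d), ‖R⁻¹ • u‖ = ‖u‖ / R := fun u => by
    rw [norm_smul, norm_inv, Real.norm_of_nonneg hR.le, div_eq_inv_mul]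
  set f := chartProfile Γ Ψ g₀ (fun u => θ (R⁻¹ • u)) with hf
  have hf01 : ∀ x, 0 ≤ f x ∧ f x ≤ 1 := fun x => by
    classical
    rw [hf]
    simp only [chartProfile, Function.extend_def]
    split_ifs
    · exact ⟨θ.nonneg, θ.le_one⟩
    · simp
  refine ⟨f, ?_, fun x => (hf01 x).1, fun x => (hf01 x).2, fun x hx => ?_, fun x hx => ?_, ?_⟩
  · refine smoothQuot_chartProfile hΨ hinj hsΨ (θ.contDiff.comp (contDiff_id.const_smul R⁻¹))
      fun u hu => ?_
    by_contra h
    have := hθ0 _ h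
    rw [hnorm, div_lt_iff₀ hR] at this
    nlinarith
  · have hx' : x ∈ {x : G ⧸ Γ | homEDist d x (g₀ : G ⧸ Γ) < ENNReal.ofReal R} := hx
    rw [setOf_homEDist_lt hmetric] at hx'
    obtain ⟨z, hz, rfl⟩ := hx'
    have hzR : riemannianEDist (𝓡 d) z 1 < ENNReal.ofReal R := hz
    have hzs : z ∈ Ψ.source := htΨ (hzR.trans_le (ENNReal.ofReal_le_ofReal hRt.le))
    rw [hf, chartProfile_mk hinj hzs]
    refine θ.one_of_mem_closedBall ?_
    have h2 : ENNReal.ofReal ‖Ψ z‖ ≤ ENNReal.ofReal (c * R) := by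
      refine (hdist z hzs).1.trans ?_
      rw [ENNReal.ofReal_mul hc0.le]
      exact mul_le_mul_right hzR.le _
    rw [ENNReal.ofReal_le_ofReal_iff (by positivity)] at h2
    rw [mem_closedBall_zero_iff, hnorm, div_le_iff₀ hR]
    exact h2
  · have hex : ∃ z ∈ Ψ.source, ((z * g₀ : G) : G ⧸ Γ) = x := by
      by_contra h
      exact hx (chartProfile_eq_zero fun z hz hzx => h ⟨z, hz, hzx⟩)
    obtain ⟨z, hzs, rfl⟩ := hex
    rw [hf, chartProfile_mk hinj hzs] at hx
    have h2 := hθ0 _ hx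
    rw [hnorm, div_lt_iff₀ hR] at h2
    have h3 : riemannianEDist (𝓡 d) z 1 < ENNReal.ofReal (b * R) := by
      refine (hdist z hzs).2.trans_lt ?_
      change ENNReal.ofReal c * ENNReal.ofReal ‖Ψ z‖ < _
      rw [← ENNReal.ofReal_mul hc0.le, ENNReal.ofReal_lt_ofReal_iff (by positivity)]
      calc c * ‖Ψ z‖ < c * (c ^ 2 * R) := by gcongr
        _ = c ^ 3 * R := by ring
        _ ≤ b * R := by gcongr
    have h4 : ((z * g₀ : G) : G ⧸ Γ) ∈
        {x : G ⧸ Γ | homEDist d x (g₀ : G ⧸ Γ) < ENNReal.ofReal (b * R)} := by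
      rw [setOf_homEDist_lt hmetric]
      exact ⟨z, h3, rfl⟩
    exact h4
  · rw [div_eq_mul_inv]
    refine ((hC R hR hRs).mono (by positivity) (le_max_left C 1) le_rfl).of_abs_le_one
      (le_max_right _ _) (by positivity) fun x => ?_
    rw [abs_of_nonneg (hf01 x).1]
    exact (hf01 x).2

end Bump

/-! ### Multiple mixing -/

section Mixing

variable {d : ℕ} {G : Type*} [TopologicalSpace G] [T2Space G]
  [ChartedSpace (EuclideanSpace ℝ (Fin d)) G] [Group G] [LieGroup (𝓡 d) ∞ G] {Γ : Subgroup G}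

theorem HasDerivBound.comp_flow {a : Multiplicative ℝ →ₜ* G} {ζ : Fin d → LieAlg d G}
    {γs : Fin d → ℝ}
    (hAd : ∀ (t : ℝ) (i : Fin d),
      lieAd d (a (Multiplicative.ofAdd t)) (ζ i) = Real.exp (γs i * t) • ζ i)
    {γ : ℝ} (hγ : ∀ i, γs i ≤ γ) {k : ℕ} {A B : ℝ} {f : G ⧸ Γ → ℝ} (hfs : SmoothQuot d f)
    (hB : 0 ≤ B) (hf : HasDerivBound ζ k A B f) {t : ℝ} (ht : 0 ≤ t) :
    HasDerivBound ζ k A (Real.exp (γ * t) * B) (fun x => f (a (Multiplicative.ofAdd t) • x)) := by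
  refine hf.comp_smul hfs (hAd t) (fun i => ?_) (Real.exp_nonneg _) hB
  rw [abs_of_pos (Real.exp_pos _)]
  exact Real.exp_le_exp.2 (mul_le_mul_of_nonneg_right (hγ i) ht)

variable [MeasurableSpace (G ⧸ Γ)] [BorelSpace (G ⧸ Γ)] {μ : Measure (G ⧸ Γ)}
  [IsProbabilityMeasure μ]

/-- Multiple mixing along a lacunary sequence of times, by peeling off the last factor: the
derivatives of the product of the first factors are of order `exp (γ m (j - 1))`, and
`γ k m (j - 1) ≤ (γ k / ρ) m j` is beaten by the decay `exp (- δ m j)`. -/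
theorem exists_abs_integral_prod_sub_pow_le {a : Multiplicative ℝ →ₜ* G} {ζ : Fin d → LieAlg d G}
    {γs : Fin d → ℝ}
    (hAd : ∀ (t : ℝ) (i : Fin d),
      lieAd d (a (Multiplicative.ofAdd t)) (ζ i) = Real.exp (γs i * t) • ζ i)
    {γ : ℝ} (hγ : ∀ i, γs i ≤ γ) (hγ0 : 0 ≤ γ) {k : ℕ} {δ : ℝ} (hmix : HasExpDecay a ζ μ k δ)
    {m : ℕ → ℝ} (hm : ∀ j, 0 < m j) (hmono : Monotone m) {ρ : ℝ}
    (hρ : ∀ j, m j ≤ m (j + 1) / ρ) (hδ : 0 ≤ δ - k * γ / ρ) :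
    ∃ K : ℝ, 0 < K ∧ ∀ (f : G ⧸ Γ → ℝ) (B : ℝ) (α N : ℕ), SmoothQuot d f → (∀ x, 0 ≤ f x) →
      (∀ x, f x ≤ 1) → HasDerivBound ζ k 1 B f → 1 ≤ B →
      |∫ x, ∏ i ∈ Finset.range N, f (a (Multiplicative.ofAdd (m (α + i))) • x) ∂μ
          - (∫ x, f x ∂μ) ^ N| ≤
        N * (K * N ^ k * B ^ (2 * k) * Real.exp (-((δ - k * γ / ρ) * m α))) := by
  obtain ⟨c, hc, hmix⟩ := hmix
  set S : ℝ := √(∑ l ∈ Finset.range (k + 1), (d : ℝ) ^ l) with hS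
  have hS0 : 0 < S := by
    refine Real.sqrt_pos.2 ?_
    rw [Finset.sum_range_succ', pow_zero]
    positivity
  refine ⟨c * S ^ 2, by positivity, fun f B α N hfs hf0 hf1 hf hB => ?_⟩
  have hB0 : 0 ≤ B := by linarith
  set I := ∫ x, f x ∂μ with hI
  have hI0 : 0 ≤ I := integral_nonneg hf0
  have hI1 : I ≤ 1 := by
    have := integral_mono_of_nonneg (μ := μ) (Eventually.of_forall hf0)
      (integrable_const (1 : ℝ)) (Eventually.of_forall hf1)
    simpa using this
  set E := c * S ^ 2 * N ^ k * B ^ (2 * k) * Real.exp (-((δ - k * γ / ρ) * m α)) with hE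
  have key : ∀ n ≤ N, |∫ x, ∏ i ∈ Finset.range n, f (a (Multiplicative.ofAdd (m (α + i))) • x) ∂μ
      - I ^ n| ≤ n * E := by
    intro n
    induction n with
    | zero => simp
    | succ n ih =>
      intro hn
      have hN1 : (1 : ℝ) ≤ N := by exact_mod_cast (Nat.succ_pos n).trans_le hn
      set F : G ⧸ Γ → ℝ := fun x =>
        ∏ i ∈ Finset.range n, f (a (Multiplicative.ofAdd (m (α + i))) • x) with hF
      have hFs : SmoothQuot d F := SmoothQuot.prod _ fun i _ => hfs.smul_left _
      have hFb : HasDerivBound ζ k 1 (∑ i ∈ Finset.range n, Real.exp (γ * m (α + i)) * B) F :=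
        HasDerivBound.prod _ (fun i _ => hfs.smul_left _)
          fun i _ => hf.comp_flow hAd hγ hfs hB0 (hm _).le
      set e := Real.exp (γ * (m (α + n) / ρ)) with he
      have hmρ : ∀ i < n, m (α + i) ≤ m (α + n) / ρ := by
        intro i hi
        obtain ⟨n', rfl⟩ := Nat.exists_eq_add_of_lt hi
        exact (hmono (by omega)).trans (hρ (α + (i + n')))
      have he1 : 1 ≤ e := by
        rw [he]
        refine Real.one_le_exp (mul_nonneg hγ0 ?_)
        have h0 := (hm 0).le.trans (hρ 0)
        have hρ0 : 0 ≤ ρ := by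
          by_contra h
          exact (div_neg_of_pos_of_neg (hm (0 + 1)) (not_le.1 h)).not_ge h0
        exact div_nonneg (hm _).le hρ0
      have hsum : max 1 (∑ i ∈ Finset.range n, Real.exp (γ * m (α + i)) * B) ≤ N * B * e := by
        refine max_le ?_ ?_
        · calc (1 : ℝ) = 1 * 1 * 1 := by norm_num
            _ ≤ N * B * e := by gcongr
        · calc ∑ i ∈ Finset.range n, Real.exp (γ * m (α + i)) * B
              ≤ ∑ i ∈ Finset.range n, e * B := by
                refine Finset.sum_le_sum fun i hi => ?_
                have := hmρ i (Finset.mem_range.1 hi)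
                rw [he]
                gcongr
            _ = n * B * e := by simp; ring
            _ ≤ N * B * e := by
                have : (n : ℝ) ≤ N := by exact_mod_cast (Nat.le_succ n).trans hn
                gcongr
      have hSF : sobolevNorm ζ μ k F ≤ S * (N * B * e) ^ k := by
        refine (hFb.sobolevNorm_le (Finset.sum_nonneg fun i _ => by positivity)).trans ?_
        rw [one_mul]
        gcongr
      have hSf : sobolevNorm ζ μ k f ≤ S * B ^ k := by
        have := hf.sobolevNorm_le (μ := μ) hB0
        rwa [one_mul, max_eq_right hB] at this
      have h1 := hmix F f (hFb.memSobolev hFs) (hf.memSobolev hfs) (m (α + n)) (hm _).le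
      have h2 : c * Real.exp (-(δ * m (α + n))) * sobolevNorm ζ μ k F * sobolevNorm ζ μ k f ≤ E := by
        calc c * Real.exp (-(δ * m (α + n))) * sobolevNorm ζ μ k F * sobolevNorm ζ μ k f
            ≤ c * Real.exp (-(δ * m (α + n))) * (S * (N * B * e) ^ k) * (S * B ^ k) := by
              have : 0 ≤ sobolevNorm ζ μ k f := Real.sqrt_nonneg _
              gcongr
          _ = c * S ^ 2 * N ^ k * B ^ (2 * k) * (Real.exp (-(δ * m (α + n))) * e ^ k) := by ring
          _ ≤ E := by
              rw [hE, he, ← Real.exp_nat_mul, ← Real.exp_add]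
              gcongr
              have := mul_le_mul_of_nonneg_left (hmono (Nat.le_add_right α n)) hδ
              calc -(δ * m (α + n)) + k * (γ * (m (α + n) / ρ))
                  = -((δ - k * γ / ρ) * m (α + n)) := by ring
                _ ≤ -((δ - k * γ / ρ) * m α) := neg_le_neg this
      have h3 : |(∫ x, F x ∂μ) * I - I ^ n * I| ≤ n * E := by
        rw [← sub_mul, abs_mul, abs_of_nonneg hI0]
        exact (mul_le_of_le_one_right (abs_nonneg _) hI1).trans (ih (Nat.le_of_succ_le hn))
      simp only [Finset.prod_range_succ]
      rw [pow_succ]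
      calc _ ≤ |∫ x, F x * f (a (Multiplicative.ofAdd (m (α + n))) • x) ∂μ - (∫ x, F x ∂μ) * I|
            + |(∫ x, F x ∂μ) * I - I ^ n * I| := abs_sub_le _ _ _
        _ ≤ E + n * E := add_le_add (h1.trans h2) h3
        _ = ((n + 1 : ℕ) : ℝ) * E := by push_cast; ring
  exact key N le_rfl

end Mixing

/-! ### The probability of avoiding a shrinking ball -/

section Limits

theorem tendsto_one_sub_pow_exp {ι : Type*} {l : Filter ι} {p : ι → ℝ} {N : ι → ℕ} {τ : ℝ}
    (hN : Tendsto N l atTop) (h : Tendsto (fun i => N i * p i) l (𝓝 τ)) :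
    Tendsto (fun i => (1 - p i) ^ N i) l (𝓝 (Real.exp (-τ))) := by
  have hN' : Tendsto (fun i => (N i : ℝ)) l atTop := tendsto_natCast_atTop_atTop.comp hN
  have hp : Tendsto p l (𝓝 0) := by
    refine (h.div_atTop hN').congr' ?_
    filter_upwards [hN'.eventually_gt_atTop 0] with i hi
    field_simp
  have hq : Tendsto (fun i => 1 - p i) l (𝓝 1) := by simpa using hp.const_sub 1
  have hpos : ∀ᶠ i in l, 0 < 1 - p i := hq.eventually_const_lt one_pos
  -- `1 - 1 / q ≤ log q ≤ q - 1` for `q = 1 - p`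
  have hlog : Tendsto (fun i => N i * Real.log (1 - p i)) l (𝓝 (-τ)) := by
    have h1 : Tendsto (fun i => -(N i * p i) / (1 - p i)) l (𝓝 (-τ)) := by
      have := h.neg.div hq one_ne_zero
      rwa [div_one] at this
    refine tendsto_of_tendsto_of_tendsto_of_le_of_le' h1 h.neg ?_ ?_
    · filter_upwards [hpos] with i hi
      calc -(N i * p i) / (1 - p i) = N i * (1 - (1 - p i)⁻¹) := by field_simp; ring
        _ ≤ N i * Real.log (1 - p i) := by
            gcongr; exact Real.one_sub_inv_le_log_of_pos hi
    · filter_upwards [hpos] with i hi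
      calc N i * Real.log (1 - p i) ≤ N i * (1 - p i - 1) := by
            gcongr; exact Real.log_le_sub_one_of_pos hi
        _ = -(N i * p i) := by ring
  refine ((Real.continuous_exp.tendsto _).comp hlog).congr' ?_
  filter_upwards [hpos] with i hi
  rw [Function.comp_apply, Real.exp_nat_mul, Real.exp_log hi]

variable {d : ℕ} {G : Type*} [TopologicalSpace G] [ChartedSpace (EuclideanSpace ℝ (Fin d)) G]
  [Group G] [RiemannianBundle (fun x : G => TangentSpace (𝓡 d) x)] {Γ : Subgroup G}

theorem negLogDist_le_coe_iff {x₀ x : G ⧸ Γ} {u : ℝ} :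
    negLogDist d x₀ x ≤ (u : EReal) ↔ ENNReal.ofReal (Real.exp (-u)) ≤ homEDist d x x₀ := by
  rw [← ENNReal.log_le_log_iff, ENNReal.log_ofReal_of_pos (Real.exp_pos _), Real.log_exp,
    negLogDist, EReal.neg_le, EReal.coe_neg]

theorem coe_le_negLogDist_iff {x₀ x : G ⧸ Γ} {u : ℝ} :
    (u : EReal) ≤ negLogDist d x₀ x ↔ homEDist d x x₀ ≤ ENNReal.ofReal (Real.exp (-u)) := by
  rw [← ENNReal.log_le_log_iff, ENNReal.log_ofReal_of_pos (Real.exp_pos _), Real.log_exp,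
    negLogDist, EReal.le_neg, EReal.coe_neg]

theorem maxReturn_le_coe_iff {a : Multiplicative ℝ →ₜ* G} {m : ℕ → ℝ}
    {α β : ℕ} (hαβ : α < β) {x₀ x : G ⧸ Γ} {u : ℝ} :
    maxReturn d a m α β x₀ x ≤ (u : EReal) ↔ ∀ i < β - α + 1, ENNReal.ofReal (Real.exp (-u)) ≤
      homEDist d (a (Multiplicative.ofAdd (m (α + i))) • x) x₀ := by
  simp only [maxReturn, Finset.sup_le_iff, Finset.mem_Icc, negLogDist_le_coe_iff]
  constructor
  · exact fun h i hi => h (α + i) ⟨by omega, by omega⟩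
  · intro h j hj
    obtain ⟨i, rfl⟩ := Nat.exists_eq_add_of_le hj.1
    exact h i (by omega)

variable [MeasurableSpace (G ⧸ Γ)] {μ : Measure (G ⧸ Γ)} {w : ℝ} {x₀ : G ⧸ Γ}

/-- Closed balls have the same asymptotic measure as open balls. -/
theorem tendsto_measure_homEDist_le [IsFiniteMeasure μ]
    (hw : Tendsto (fun R : ℝ => μ.real {x | homEDist d x x₀ < ENNReal.ofReal R} / R ^ d)
      (𝓝[>] 0) (𝓝 w)) :
    Tendsto (fun R : ℝ => μ.real {x | homEDist d x x₀ ≤ ENNReal.ofReal R} / R ^ d)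
      (𝓝[>] 0) (𝓝 w) := by
  rw [tendsto_order]
  constructor
  · intro l hl
    filter_upwards [hw.eventually_const_lt hl, self_mem_nhdsWithin] with R hR hR0
    refine hR.trans_le ?_
    have hR0 : 0 < R := hR0
    refine div_le_div_of_nonneg_right (measureReal_mono ?_) (by positivity)
    intro x (hx : homEDist d x x₀ < _)
    exact hx.le
  · intro u hu
    have hs : Tendsto (fun s : ℝ => w * s ^ d) (𝓝[>] 1) (𝓝 w) :=
      (Continuous.tendsto' (by fun_prop) _ _ (by simp)).mono_left nhdsWithin_le_nhds
    obtain ⟨s, hsu, hs1⟩ := ((hs.eventually_lt_const hu).and self_mem_nhdsWithin).exists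
    have hs1 : 1 < s := hs1
    have hs0 : 0 < s := by linarith
    have hsc : Tendsto (fun R : ℝ => s * R) (𝓝[>] 0) (𝓝[>] 0) :=
      tendsto_nhdsWithin_iff.2 ⟨(Continuous.tendsto' (by fun_prop) _ _ (by simp)).mono_left
        nhdsWithin_le_nhds, by
          filter_upwards [self_mem_nhdsWithin] with R hR using mul_pos hs0 hR⟩
    filter_upwards [((hw.comp hsc).mul_const (s ^ d)).eventually_lt_const hsu,
      self_mem_nhdsWithin] with R hR hR0
    have hR0 : 0 < R := hR0
    refine lt_of_le_of_lt ?_ hR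
    have e : μ.real {x | homEDist d x x₀ < ENNReal.ofReal (s * R)} / (s * R) ^ d * s ^ d =
        μ.real {x | homEDist d x x₀ < ENNReal.ofReal (s * R)} / R ^ d := by
      rw [mul_pow]
      field_simp
    rw [Function.comp_apply, e]
    refine div_le_div_of_nonneg_right (measureReal_mono ?_) (by positivity)
    intro x (hx : homEDist d x x₀ ≤ _)
    refine hx.trans_lt ?_
    rw [ENNReal.ofReal_lt_ofReal_iff (by positivity)]
    nlinarith

theorem tendsto_mul_measure_homEDist_lt
    (hw : Tendsto (fun R : ℝ => μ.real {x | homEDist d x x₀ < ENNReal.ofReal R} / R ^ d)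
      (𝓝[>] 0) (𝓝 w)) {N : ℕ → ℕ} {R : ℕ → ℝ} (hR0 : ∀ n, 0 < R n) (hR : Tendsto R atTop (𝓝 0))
    {T : ℝ} (hT : Tendsto (fun n => N n * R n ^ d) atTop (𝓝 T)) {s : ℝ} (hs : 0 < s) :
    Tendsto (fun n => N n * μ.real {x | homEDist d x x₀ < ENNReal.ofReal (s * R n)}) atTop
      (𝓝 (w * T * s ^ d)) := by
  have hsR : Tendsto (fun n => s * R n) atTop (𝓝[>] 0) :=
    tendsto_nhdsWithin_iff.2 ⟨by simpa using hR.const_mul s,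
      Eventually.of_forall fun n => mul_pos hs (hR0 n)⟩
  refine (((hw.comp hsR).mul hT).mul_const (s ^ d)).congr fun n => ?_
  have := (hR0 n).ne'
  rw [Function.comp_apply, mul_pow]
  field_simp

end Limits

section ExtremeValueLaw

variable {d : ℕ} {G : Type*} [TopologicalSpace G] [T2Space G]
  [ChartedSpace (EuclideanSpace ℝ (Fin d)) G]
  [Group G] [LieGroup (𝓡 d) ∞ G] [RiemannianBundle (fun x : G => TangentSpace (𝓡 d) x)]
  [IsContMDiffRiemannianBundle (𝓡 d) ∞ (EuclideanSpace ℝ (Fin d))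
      (fun x : G => TangentSpace (𝓡 d) x)]

/-- Let `f` be a smooth bump function for the ball of radius `R n`. If the functions `f ∘ T n i`,
`i < N n`, are independent up to a negligible error, then the probability that all of the `N n`
points `T n i • x` avoid the ball is asymptotically the same as for `N n` independent points, each
of which hits the ball with probability about `w t / N n`. The error `η n B` is allowed to depend on a bound `B` for
the derivatives of the observable; at scale `R n` this is a constant over `R n`. -/
theorem tendsto_measure_forall_le_homEDist (hmetric : IsRightInvariantMetric d G) (Γ : Subgroup G)
    [DiscreteTopology Γ] [MeasurableSpace (G ⧸ Γ)] [BorelSpace (G ⧸ Γ)] (μ : Measure (G ⧸ Γ))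
    [IsProbabilityMeasure μ] (ζ : Fin d → LieAlg d G) (k : ℕ) {w : ℝ} {x₀ : G ⧸ Γ}
    (hw : Tendsto (fun R : ℝ => μ.real {x | homEDist d x x₀ < ENNReal.ofReal R} / R ^ d)
      (𝓝[>] 0) (𝓝 w)) {N : ℕ → ℕ} (hN : Tendsto N atTop atTop)
    {R : ℕ → ℝ} (hR0 : ∀ n, 0 < R n) (hR : Tendsto R atTop (𝓝 0))
    {t : ℝ} (ht : Tendsto (fun n => N n * R n ^ d) atTop (𝓝 t)) {T : ℕ → ℕ → G}
    {η : ℕ → ℝ → ℝ}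
    (hmix : ∀ (f : G ⧸ Γ → ℝ) (B : ℝ) (n : ℕ), SmoothQuot d f → (∀ x, 0 ≤ f x) → (∀ x, f x ≤ 1) →
      HasDerivBound ζ k 1 B f → 1 ≤ B →
      |∫ x, ∏ i ∈ Finset.range (N n), f (T n i • x) ∂μ - (∫ x, f x ∂μ) ^ N n| ≤ η n B)
    (hη : ∀ C : ℝ, Tendsto (fun n => η n (C / R n)) atTop (𝓝 0)) :
    Tendsto (fun n => μ.real
        {x | ∀ i < N n, ENNReal.ofReal (R n) ≤ homEDist d (T n i • x) x₀}) atTop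
      (𝓝 (Real.exp (-(w * t)))) := by
  have htop : IsTopologicalGroup G := topologicalGroup_of_lieGroup (𝓡 d) ∞
  have hball : ∀ r, MeasurableSet {x : G ⧸ Γ | homEDist d x x₀ < r} := fun r =>
    (isOpen_setOf_homEDist_lt hmetric Γ x₀ r).measurableSet
  have hE : ∀ n, MeasurableSet
      {x | ∀ i < N n, ENNReal.ofReal (R n) ≤ homEDist d (T n i • x) x₀} := by
    intro n
    have : {x | ∀ i < N n, ENNReal.ofReal (R n) ≤ homEDist d (T n i • x) x₀} =
        ⋂ i ∈ Finset.range (N n), (fun x : G ⧸ Γ => T n i • x) ⁻¹'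
          {x | homEDist d x x₀ < ENNReal.ofReal (R n)}ᶜ := by
      ext x; simp
    rw [this]
    exact Finset.measurableSet_biInter _ fun i _ =>
      (hball _).compl.preimage (continuous_const_smul (T n i)).measurable
  -- the error at bumps of size comparable to `R n`
  have hbump : ∀ {b s : ℝ}, 1 < b → 0 < s → ∃ e : ℕ → ℝ, Tendsto e atTop (𝓝 0) ∧
      ∀ᶠ n in atTop, ∃ f : G ⧸ Γ → ℝ, SmoothQuot d f ∧ (∀ x, 0 ≤ f x) ∧ (∀ x, f x ≤ 1) ∧
        (∀ x, homEDist d x x₀ < ENNReal.ofReal (s * R n) → f x = 1) ∧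
        (∀ x, f x ≠ 0 → homEDist d x x₀ < ENNReal.ofReal (b * (s * R n))) ∧
        |∫ x, ∏ i ∈ Finset.range (N n), (1 - f (T n i • x)) ∂μ - (1 - ∫ x, f x ∂μ) ^ N n|
          ≤ e n := by
    intro b s hb hs
    obtain ⟨C, R₀, hC, hR₀, hf⟩ := exists_bump_homEDist hmetric Γ ζ k x₀ hb
    refine ⟨fun n => η n (C / s / R n), hη _, ?_⟩
    have h1 : ∀ᶠ n in atTop, R n < R₀ / s := hR.eventually_lt_const (by positivity)
    have h2 : ∀ᶠ n in atTop, R n < C / s := hR.eventually_lt_const (by positivity)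
    filter_upwards [h1, h2] with n hn1 hn2
    obtain ⟨f, hfs, hf0, hf1, hfin, hfout, hfB⟩ := hf (s * R n) (mul_pos hs (hR0 n))
      (by rw [lt_div_iff₀ hs] at hn1; linarith)
    refine ⟨f, hfs, hf0, hf1, hfin, hfout, ?_⟩
    have h := hmix (fun x => 1 - f x) (C / s / R n) n hfs.one_sub (fun x => by linarith [hf1 x])
      (fun x => by linarith [hf0 x])
      ((by rwa [div_div] : HasDerivBound ζ k 1 (C / s / R n) f).one_sub hf0)
      ((one_le_div (hR0 n)).2 hn2.le)
    have hint : Integrable f μ := Integrable.of_bound hfs.continuous.aestronglyMeasurable 1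
      (Eventually.of_forall fun x => by rw [Real.norm_of_nonneg (hf0 x)]; exact hf1 x)
    rwa [integral_sub (integrable_const 1) hint, integral_const, probReal_univ, one_smul] at h
  have hprod01 : ∀ {n} {f : G ⧸ Γ → ℝ}, SmoothQuot d f → (∀ x, 0 ≤ f x) → (∀ x, f x ≤ 1) →
      (∀ x, 0 ≤ ∏ i ∈ Finset.range (N n), (1 - f (T n i • x)) ∧
        ∏ i ∈ Finset.range (N n), (1 - f (T n i • x)) ≤ 1) ∧
      Integrable (fun x => ∏ i ∈ Finset.range (N n), (1 - f (T n i • x))) μ := by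
    intro n f hfs hf0 hf1
    have h01 : ∀ x, 0 ≤ ∏ i ∈ Finset.range (N n), (1 - f (T n i • x)) ∧
        ∏ i ∈ Finset.range (N n), (1 - f (T n i • x)) ≤ 1 := fun x =>
      ⟨Finset.prod_nonneg fun i _ => sub_nonneg.2 (hf1 _),
        Finset.prod_le_one (fun i _ => sub_nonneg.2 (hf1 _))
          fun i _ => sub_le_self _ (hf0 _)⟩
    refine ⟨h01, Integrable.of_bound (Continuous.aestronglyMeasurable ?_) 1
      (Eventually.of_forall fun x => by rw [Real.norm_of_nonneg (h01 x).1]; exact (h01 x).2)⟩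
    exact (SmoothQuot.prod _ fun i _ => (hfs.one_sub.smul_left (T n i))).continuous
  rw [tendsto_order]
  constructor
  · intro l hl
    have hs : Tendsto (fun s : ℝ => Real.exp (-(w * t * s ^ d))) (𝓝[>] 1)
        (𝓝 (Real.exp (-(w * t)))) :=
      (Continuous.tendsto' (by fun_prop) _ _ (by simp)).mono_left nhdsWithin_le_nhds
    obtain ⟨b, hbl, hb⟩ := ((hs.eventually_const_lt hl).and self_mem_nhdsWithin).exists
    have hb : 1 < b := hb
    obtain ⟨e, he, hev⟩ := hbump hb one_pos
    have hlim := (tendsto_one_sub_pow_exp hN (tendsto_mul_measure_homEDist_lt hw hR0 hR ht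
      (s := b) (by linarith))).sub he
    rw [sub_zero] at hlim
    filter_upwards [hlim.eventually_const_lt hbl, hev] with n hn ⟨f, hfs, hf0, hf1, hfin, hfout, hfe⟩
    simp only [one_mul] at hfin hfout
    refine hn.trans_le ?_
    obtain ⟨h01, hint⟩ := hprod01 (n := n) hfs hf0 hf1
    have hI : ∫ x, f x ∂μ ≤ μ.real {x | homEDist d x x₀ < ENNReal.ofReal (b * R n)} := by
      rw [← integral_indicator_one (hball _)]
      refine integral_mono_of_nonneg (Eventually.of_forall hf0)
        ((integrable_const (1 : ℝ)).indicator (hball _)) (Eventually.of_forall fun x => ?_)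
      by_cases hx : f x = 0
      · simp only [hx]; exact Set.indicator_nonneg (fun _ _ => zero_le_one) x
      · have hx' : x ∈ {x | homEDist d x x₀ < ENNReal.ofReal (b * R n)} := hfout x hx
        rw [Set.indicator_of_mem hx']; exact hf1 x
    have hP : ∫ x, ∏ i ∈ Finset.range (N n), (1 - f (T n i • x)) ∂μ ≤ μ.real
        {x | ∀ i < N n, ENNReal.ofReal (R n) ≤ homEDist d (T n i • x) x₀} := by
      rw [← integral_indicator_one (hE n)]
      refine integral_mono hint ((integrable_const (1 : ℝ)).indicator (hE n)) fun x => ?_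
      by_cases hx : x ∈ {x | ∀ i < N n, ENNReal.ofReal (R n) ≤ homEDist d (T n i • x) x₀}
      · rw [Set.indicator_of_mem hx]; exact (h01 x).2
      · rw [Set.indicator_of_notMem hx]
        simp only [Set.mem_ofPred_eq, not_forall, not_le] at hx
        obtain ⟨i, hi, hix⟩ := hx
        exact (Finset.prod_eq_zero (Finset.mem_range.2 hi)
          (by rw [hfin _ hix, sub_self])).le
    have hV : (1 - μ.real {x | homEDist d x x₀ < ENNReal.ofReal (b * R n)}) ^ N n
        ≤ (1 - ∫ x, f x ∂μ) ^ N n :=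
      pow_le_pow_left₀ (sub_nonneg.2 measureReal_le_one) (sub_le_sub_left hI 1) _
    linarith [(abs_le.1 hfe).1]
  · intro u hu
    have hs : Tendsto (fun s : ℝ => Real.exp (-(w * t * s⁻¹ ^ d))) (𝓝[>] 1)
        (𝓝 (Real.exp (-(w * t)))) := by
      have : ContinuousAt (fun s : ℝ => Real.exp (-(w * t * s⁻¹ ^ d))) 1 := by
        refine ContinuousAt.rexp (ContinuousAt.neg (ContinuousAt.mul continuousAt_const
          (ContinuousAt.pow (continuousAt_inv₀ one_ne_zero) d)))
      have h2 := this.tendsto.mono_left (nhdsWithin_le_nhds (s := Set.Ioi 1))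
      simpa using h2
    obtain ⟨b, hbu, hb⟩ := ((hs.eventually_lt_const hu).and self_mem_nhdsWithin).exists
    have hb : 1 < b := hb
    have hb0 : 0 < b := by linarith
    obtain ⟨e, he, hev⟩ := hbump hb (s := b⁻¹) (by positivity)
    have hlim := (tendsto_one_sub_pow_exp hN (tendsto_mul_measure_homEDist_lt hw hR0 hR ht
      (s := b⁻¹) (by positivity))).add he
    rw [add_zero] at hlim
    filter_upwards [hlim.eventually_lt_const hbu, hev] with n hn ⟨f, hfs, hf0, hf1, hfin, hfout, hfe⟩
    rw [mul_inv_cancel_left₀ hb0.ne'] at hfout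
    refine lt_of_le_of_lt ?_ hn
    obtain ⟨h01, hint⟩ := hprod01 (n := n) hfs hf0 hf1
    have hfint : Integrable f μ := Integrable.of_bound hfs.continuous.aestronglyMeasurable 1
      (Eventually.of_forall fun x => by rw [Real.norm_of_nonneg (hf0 x)]; exact hf1 x)
    have hI : μ.real {x | homEDist d x x₀ < ENNReal.ofReal (b⁻¹ * R n)} ≤ ∫ x, f x ∂μ := by
      rw [← integral_indicator_one (hball _)]
      refine integral_mono ((integrable_const (1 : ℝ)).indicator (hball _)) hfint fun x => ?_
      by_cases hx : x ∈ {x | homEDist d x x₀ < ENNReal.ofReal (b⁻¹ * R n)}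
      · rw [Set.indicator_of_mem hx, hfin x hx]; rfl
      · rw [Set.indicator_of_notMem hx]; exact hf0 x
    have hI1 : ∫ x, f x ∂μ ≤ 1 := by
      simpa using integral_mono hfint (integrable_const (1 : ℝ)) hf1
    have hP : μ.real {x | ∀ i < N n, ENNReal.ofReal (R n) ≤ homEDist d (T n i • x) x₀} ≤
        ∫ x, ∏ i ∈ Finset.range (N n), (1 - f (T n i • x)) ∂μ := by
      rw [← integral_indicator_one (hE n)]
      refine integral_mono ((integrable_const (1 : ℝ)).indicator (hE n)) hint fun x => ?_
      by_cases hx : x ∈ {x | ∀ i < N n, ENNReal.ofReal (R n) ≤ homEDist d (T n i • x) x₀}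
      · rw [Set.indicator_of_mem hx]
        refine (Finset.prod_eq_one fun i hi => ?_).ge
        have : f (T n i • x) = 0 := by
          by_contra h
          exact (hfout _ h).not_ge (hx i (Finset.mem_range.1 hi))
        rw [this, sub_zero]
      · rw [Set.indicator_of_notMem hx]; exact (h01 x).1
    have hV : (1 - ∫ x, f x ∂μ) ^ N n ≤
        (1 - μ.real {x | homEDist d x x₀ < ENNReal.ofReal (b⁻¹ * R n)}) ^ N n :=
      pow_le_pow_left₀ (sub_nonneg.2 hI1) (sub_le_sub_left hI 1) _
    linarith [(abs_le.1 hfe).2]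

end ExtremeValueLaw

/-! ### Rates, and the extreme value law -/

section Rates

/-- The window condition makes the total decorrelation error negligible. The exponent
`1 + k + 2 k / d` of the window length that occurs here is at most
`k (3 / 2 + 2 / d) + 1 / 2`, as `1 ≤ k`. -/
theorem tendsto_error_bound {d : ℕ} {k : ℕ} (hk : 1 ≤ k) {N α : ℕ → ℕ} {m : ℕ → ℝ}
    (hN : ∀ n, 1 ≤ N n) {ρ κ σ : ℝ} (hκ : 0 < κ) (hm0 : 0 < m 0) (hm : ∀ j, m 0 * ρ ^ j ≤ m j)
    (hσ : σ = m 0 * κ / (k * (3 / 2 + 2 / (d : ℝ)) + 1 / 2))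
    (hNσ : (fun n => (N n : ℝ)) =o[atTop] fun n => Real.exp (σ * ρ ^ α n)) (K r C : ℝ) :
    Tendsto (fun n => N n * (K * N n ^ k *
        (C / Real.exp (-(r + 1 / (d : ℝ) * Real.log (N n)))) ^ (2 * k) *
          Real.exp (-(κ * m (α n))))) atTop (𝓝 0) := by
  set P : ℝ := k * (3 / 2 + 2 / (d : ℝ)) + 1 / 2 with hP
  have hP0 : 0 < P := by positivity
  have hk' : (1 : ℝ) ≤ k := by exact_mod_cast hk
  have hNpos : ∀ n, (0 : ℝ) < N n := fun n => by exact_mod_cast hN n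
  have h0 : Tendsto (fun n => Real.exp (Real.log (N n) - σ * ρ ^ α n)) atTop (𝓝 0) := by
    refine hNσ.tendsto_div_nhds_zero.congr fun n => ?_
    rw [Real.exp_sub, Real.exp_log (hNpos n)]
  have h1 : Tendsto (fun n => Real.exp (P * (Real.log (N n) - σ * ρ ^ α n))) atTop (𝓝 0) :=
    Real.tendsto_exp_comp_nhds_zero.2
      ((Real.tendsto_exp_comp_nhds_zero.1 h0).const_mul_atBot hP0)
  have h2 := h1.const_mul (|K| * |C| ^ (2 * k) * Real.exp (2 * k * r))
  rw [mul_zero] at h2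
  refine squeeze_zero_norm (fun n => ?_) h2
  set L := Real.log (N n) with hL
  have hL0 : 0 ≤ L := Real.log_nonneg (by exact_mod_cast hN n)
  have hNL : (N n : ℝ) = Real.exp L := (Real.exp_log (hNpos n)).symm
  have e1 : (N n : ℝ) * (K * N n ^ k * (C / Real.exp (-(r + 1 / (d : ℝ) * L))) ^ (2 * k) *
      Real.exp (-(κ * m (α n)))) = K * C ^ (2 * k) *
        Real.exp (L + k * L + (2 * k : ℕ) * (r + 1 / (d : ℝ) * L) - κ * m (α n)) := by
    rw [Real.exp_sub, Real.exp_add, Real.exp_add, Real.exp_nat_mul, Real.exp_nat_mul, hNL,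
      Real.exp_neg (r + _), div_inv_eq_mul, mul_pow, Real.exp_neg]
    ring
  rw [e1, norm_mul, norm_mul, norm_pow, Real.norm_of_nonneg (Real.exp_nonneg _),
    Real.norm_eq_abs, Real.norm_eq_abs, mul_assoc _ (Real.exp _) (Real.exp _), ← Real.exp_add]
  gcongr
  have hσP : P * σ = κ * m 0 := by rw [hσ]; field_simp
  have h3 : κ * (m 0 * ρ ^ α n) ≤ κ * m (α n) := by gcongr; exact hm _
  have h4 : (1 + k + 2 * k * (1 / (d : ℝ))) * L ≤ P * L := by
    refine mul_le_mul_of_nonneg_right ?_ hL0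
    rw [hP]
    have : (k : ℝ) * (3 / 2 + 2 / (d : ℝ)) + 1 / 2 =
        3 / 2 * k + 2 * k * (1 / (d : ℝ)) + 1 / 2 := by ring
    linarith
  calc L + k * L + (2 * k : ℕ) * (r + 1 / (d : ℝ) * L) - κ * m (α n)
      = 2 * k * r + ((1 + k + 2 * k * (1 / (d : ℝ))) * L - κ * m (α n)) := by push_cast; ring
    _ ≤ 2 * k * r + (P * L - κ * (m 0 * ρ ^ α n)) := by gcongr
    _ = 2 * k * r + P * (L - σ * ρ ^ α n) := by rw [mul_sub, ← mul_assoc P σ, hσP]; ring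

end Rates

theorem mainTheorem8 {d : ℕ} (hd : 0 < d)
    -- a Lie group of dimension `d`
    {G : Type*} [TopologicalSpace G] [T2Space G] [SecondCountableTopology G]
    [ChartedSpace (EuclideanSpace ℝ (Fin d)) G] [Group G]
    [LieGroup 𝓘(ℝ, EuclideanSpace ℝ (Fin d)) ∞ G]
    -- a smooth right-invariant Riemannian metric on it
    [RiemannianBundle (fun x : G => TangentSpace 𝓘(ℝ, EuclideanSpace ℝ (Fin d)) x)]
    [IsContMDiffRiemannianBundle 𝓘(ℝ, EuclideanSpace ℝ (Fin d)) ∞ (EuclideanSpace ℝ (Fin d))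
      (fun x : G => TangentSpace 𝓘(ℝ, EuclideanSpace ℝ (Fin d)) x)]
    (hmetric : IsRightInvariantMetric d G)
    -- a lattice, and the normalized Haar measure on the quotient
    (Γ : Subgroup G) [DiscreteTopology Γ] [MeasurableSpace (G ⧸ Γ)] [BorelSpace (G ⧸ Γ)]
    (μ : Measure (G ⧸ Γ)) [IsProbabilityMeasure μ] [SMulInvariantMeasure G (G ⧸ Γ) μ]
    -- a one-parameter subgroup with diagonalizable adjoint action and an eigenbasis
    (a : Multiplicative ℝ →ₜ* G) (ζ : Module.Basis (Fin d) ℝ (LieAlg d G)) (γs : Fin d → ℝ)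
    (hAd : ∀ (t : ℝ) (i : Fin d),
      lieAd d (a (Multiplicative.ofAdd t)) (ζ i) = Real.exp (γs i * t) • ζ i)
    (γ : ℝ) (hγ : γ = ⨆ i, γs i)
    -- exponential mixing
    (k : ℕ) (δ : ℝ) (hδ : 0 < δ) (hmix : HasExpDecay a ζ μ k δ)
    -- the times
    (m : ℕ → ℝ) (hm : ∀ j, 0 < m j)
    (ρ : ℝ) (hρ : IsLUB (Set.range fun s : ℕ => m s / m (s + 1)) ρ⁻¹)
    (hρ' : ρ⁻¹ < min 1 (δ / (k * γ)))
    -- the windows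
    (α β : ℕ → ℕ) (hαβ : ∀ n, α n < β n) (hα : Tendsto α atTop atTop)
    (hN : Tendsto (fun n => β n - α n + 1) atTop atTop)
    (σ : ℝ)
    (hσ : σ = -m 0 / (k * (3 / 2 + 2 / (d : ℝ)) + 1 / 2) * (k * γ / ρ - δ))
    (hNσ : (fun n => ((β n - α n + 1 : ℕ) : ℝ)) =o[atTop]
      fun n => Real.exp (σ * ρ ^ α n)) :
    ∃ w : ℝ, 0 < w ∧ ∀ x₀ : G ⧸ Γ,
      ((fun z : ℝ => μ.real {x | (z : EReal) ≤ negLogDist d x₀ x} - w * Real.exp (-(d * z)))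
        =o[atTop] fun z : ℝ => Real.exp (-(d * z))) ∧
      ∀ r : ℝ, Tendsto
        (fun n => μ.real {x | maxReturn d a m (α n) (β n) x₀ x ≤
          ((r + 1 / (d : ℝ) * Real.log ((β n - α n + 1 : ℕ) : ℝ) : ℝ) : EReal)})
        atTop (𝓝 (Real.exp (-(w * Real.exp (-(d * r)))))) := by
  -- `0 < δ / (k γ)`, where `δ / 0 = 0`, forces `1 ≤ k` and `0 < γ`
  have hρinv : 0 < ρ⁻¹ := (div_pos (hm 0) (hm 1)).trans_le (hρ.1 ⟨0, rfl⟩)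
  have hρ0 : 0 < ρ := inv_pos.1 hρinv
  have hρ1 : 1 < ρ := by
    rw [← inv_lt_one₀ hρ0]
    exact hρ'.trans_le (min_le_left _ _)
  have hρδ : ρ⁻¹ < δ / (k * γ) := hρ'.trans_le (min_le_right _ _)
  have hkγ : 0 < k * γ := (div_pos_iff_of_pos_left hδ).1 (hρinv.trans hρδ)
  have hk : 1 ≤ k := by
    rcases Nat.eq_zero_or_pos k with h | h
    · simp [h] at hkγ
    · exact h
  have hγ0 : 0 < γ := pos_of_mul_pos_right hkγ (Nat.cast_nonneg k)
  have hκ : 0 < δ - k * γ / ρ := by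
    rw [lt_div_iff₀ hkγ] at hρδ
    rw [sub_pos, div_eq_inv_mul]
    exact hρδ
  have hγi : ∀ i, γs i ≤ γ := fun i => by
    rw [hγ]; exact le_ciSup (Set.finite_range γs).bddAbove i
  have hstep : ∀ j, m j ≤ m (j + 1) / ρ := fun j => by
    have := hρ.1 ⟨j, rfl⟩
    rw [div_le_iff₀ (hm (j + 1))] at this
    rwa [div_eq_inv_mul]
  have hmono : Monotone m := monotone_nat_of_le_succ fun j =>
    (hstep j).trans (div_le_self (hm _).le hρ1.le)
  have hgrow : ∀ j, m 0 * ρ ^ j ≤ m j := by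
    intro j
    induction j with
    | zero => simp
    | succ j ih =>
      have := (le_div_iff₀ hρ0).1 (hstep j)
      calc m 0 * ρ ^ (j + 1) = m 0 * ρ ^ j * ρ := by ring
        _ ≤ m j * ρ := by gcongr
        _ ≤ m (j + 1) := this
  have htop : IsTopologicalGroup G := topologicalGroup_of_lieGroup (𝓡 d) ∞
  obtain ⟨w, hw, hlim⟩ := exists_tendsto_measure_homEDist_lt hmetric Γ μ
  refine ⟨w, hw, fun x₀ => ⟨?_, fun r => ?_⟩⟩
  · have h1 : Tendsto (fun z : ℝ => Real.exp (-z)) atTop (𝓝[>] 0) :=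
      tendsto_nhdsWithin_iff.2 ⟨Real.tendsto_exp_neg_atTop_nhds_zero,
        Eventually.of_forall fun z => Real.exp_pos _⟩
    have h2 := ((tendsto_measure_homEDist_le (hlim x₀)).comp h1).sub_const w
    rw [sub_self] at h2
    refine (isLittleO_iff_tendsto fun z hz => ((Real.exp_pos _).ne' hz).elim).2
      (h2.congr fun z => ?_)
    have h3 : Real.exp (-z) ^ d = Real.exp (-(d * z)) := by
      rw [← Real.exp_nat_mul]; congr 1; ring
    rw [Function.comp_apply, h3, sub_div, mul_div_cancel_right₀ _ (Real.exp_pos _).ne']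
    simp only [coe_le_negLogDist_iff]
  · have hd' : (0 : ℝ) < d := by exact_mod_cast hd
    set N : ℕ → ℕ := fun n => β n - α n + 1 with hNdef
    have hN1 : ∀ n, 1 ≤ N n := fun n => Nat.le_add_left 1 _
    have hNpos : ∀ n, (0 : ℝ) < N n := fun n => by exact_mod_cast hN1 n
    set R : ℕ → ℝ := fun n => Real.exp (-(r + 1 / (d : ℝ) * Real.log (N n))) with hR
    have hRlim : Tendsto R atTop (𝓝 0) := by
      refine Real.tendsto_exp_neg_atTop_nhds_zero.comp (tendsto_atTop_add_const_left _ _ ?_)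
      exact ((Real.tendsto_log_atTop.comp (tendsto_natCast_atTop_atTop.comp hN)).const_mul_atTop
        (by positivity))
    have hNR : ∀ n, N n * R n ^ d = Real.exp (-(d * r)) := by
      intro n
      rw [hR]
      simp only
      rw [← Real.exp_nat_mul]
      nth_rw 1 [← Real.exp_log (hNpos n)]
      rw [← Real.exp_add]
      congr 1
      field_simp
      ring
    obtain ⟨K, hK, hmixing⟩ := exists_abs_integral_prod_sub_pow_le hAd hγi hγ0.le hmix hm hmono
      hstep hκ.le
    have hmain := tendsto_measure_forall_le_homEDist hmetric Γ μ ζ k (hlim x₀) (N := N) hN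
      (fun n => Real.exp_pos _) hRlim (t := Real.exp (-(d * r)))
      (tendsto_const_nhds.congr fun n => (hNR n).symm)
      (T := fun n i => a (Multiplicative.ofAdd (m (α n + i))))
      (fun f B n hfs hf0 hf1 hf hB => hmixing f B (α n) (N n) hfs hf0 hf1 hf hB)
      (tendsto_error_bound hk hN1 hκ (hm 0) hgrow (by rw [hσ]; ring) hNσ K r)
    refine hmain.congr fun n => ?_
    simp only [maxReturn_le_coe_iff (hαβ n)]
    rfl
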